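/- Let $\mathbb T=\mathbb R/\mathbb Z$ with the wrap-around distance $|t-t'|_{\mathbb T}=\min_{r\in\mathbb Z}|t-t'+r|$. For $N\in\mathbb N$ and a finite set $\Omega\subset\mathbb T$ of $M<N$ nodes, let $A=A(\Omega,N)=\left(e^{2\pi i k t}\right)_{t\in\Omega,\;k=0,\dots,N-1}\in\mathbb C^{M\times N}$ be the rectangular Vandermonde matrix and $\sigma_{\min}(A)=\min_{\|v\|_2=1}\|A^*v\|_2$ its smallest singular value. A set of nodes is a cluster if it is contained in an arc of $\mathbb T$ of length $1/N$. The set $\Omega$ is a clustered node configuration if $\Omega=\bigcup_{l=1}^L\Lambda_l$ with nonempty clusters $\Lambda_l$ and $$\rho:=N\min_{l\ne l'}\ \min_{t\in\Lambda_l,\,t'\in\Lambda_{l'}}|t-t'|_{\mathbb T}>1\qquad(\rho=\infty\text{ if }L=1).$$ Its normalized minimal separation is $N\min_{t\ne t'\in\Omega}|t-t'|_{\mathbb T}$, and its cluster complexity is $$\mathcal C:=\max_{t\in\Omega}\ \prod_{t'\in\Omega,\;0<|t-t'|_{\mathbb T}\le 1/N}\frac1{N|t-t'|_{\mathbb T}}.$$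 For $\lambda\ge2$ and $\tau>0$ let $\mathcal K(N,\lambda,\tau)$ be the set of all clustered node configurations $\Omega$ with $M<N$ nodes, with normalized minimal separation $\tau$, with largest cluster of cardinality $\lambda$, and with cluster separation $$\rho\ \ge\ 2\lambda\left(2\sqrt2\,\lambda^{\lambda}\,\zeta(2)\,\mathcal C\right)^{1/2},\qquad \zeta(2)=\frac{\pi^2}{6}.$$ Then there are absolute constants $0<c_1\le c_2$ such that for every $\lambda\ge2$ there exist $N_0\in\mathbb N$ and $\tau_0>0$, depending only on $\lambda$, such that for all $N\ge N_0$ and all $0<\tau\le\tau_0$ the minimum of $\sigma_{\min}(A(\Omega,N))$ over $\Omega\in\mathcal K(N,\lambda,\tau)$ exists and $$\sqrt N\,(c_1\tau)^{\lambda-1}\ \le\ \min_{\Omega\in\mathcal K(N,\lambda,\tau)}\sigma_{\min}(A(\Omega,N))\ \le\ \sqrt N\,(c_2\tau)^{\lambda-1}.$$ -/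

import Mathlib

/-! Nodes are points of the circle `UnitAddCircle = ℝ / ℤ`, that is, points of `[0, 1)` with the end
points identified.  Its metric is the wrap-around distance `dist t t' = min_{r ∈ ℤ} |t - t' + r|`, and
`AddCircle.toCircle t = exp (2 π i t)`. -/

/-- The rectangular Vandermonde matrix with entries `z_t ^ k`, `z_t = exp (2 π i t)`, rows indexed by
the nodes `t ∈ Ω` and columns by the exponents `k = 0, …, N - 1`. -/
noncomputable def vandermondeMatrix (N : ℕ) (Ω : Finset UnitAddCircle) : Matrix Ω (Fin N) ℂ :=
  Matrix.of fun t k => (AddCircle.toCircle (t : UnitAddCircle) : ℂ) ^ (k : ℕ)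

/-- The smallest singular value of `A`: the minimum of `‖A* v‖₂` over all `v` with `‖v‖₂ = 1`. -/
noncomputable def sigmaMin {m n : Type*} [Fintype m] [Fintype n] (A : Matrix m n ℂ) : ℝ :=
  sInf {r : ℝ | ∃ v : EuclideanSpace ℂ m, ‖v‖ = 1 ∧
    r = ‖(WithLp.toLp 2 (A.conjTranspose.mulVec v.ofLp) : EuclideanSpace ℂ n)‖}

/-- The infimum in `sigmaMin` is a minimum as soon as there is at least one row. -/
theorem sigmaMin_isLeast {m n : Type*} [Fintype m] [Fintype n] [Nonempty m] (A : Matrix m n ℂ) :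
    IsLeast {r : ℝ | ∃ v : EuclideanSpace ℂ m, ‖v‖ = 1 ∧
      r = ‖(WithLp.toLp 2 (A.conjTranspose.mulVec v.ofLp) : EuclideanSpace ℂ n)‖} (sigmaMin A) := by
  have hcont : Continuous fun v : EuclideanSpace ℂ m =>
      ‖(WithLp.toLp 2 (A.conjTranspose.mulVec v.ofLp) : EuclideanSpace ℂ n)‖ := by
    fun_prop
  have hne : (Metric.sphere (0 : EuclideanSpace ℂ m) 1).Nonempty :=
    NormedSpace.sphere_nonempty.2 zero_le_one
  have hc := (isCompact_sphere (0 : EuclideanSpace ℂ m) 1).image hcont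
  have h := hc.isLeast_sInf (hne.image _)
  have hs : {r : ℝ | ∃ v : EuclideanSpace ℂ m, ‖v‖ = 1 ∧
      r = ‖(WithLp.toLp 2 (A.conjTranspose.mulVec v.ofLp) : EuclideanSpace ℂ n)‖} =
      (fun v : EuclideanSpace ℂ m =>
        ‖(WithLp.toLp 2 (A.conjTranspose.mulVec v.ofLp) : EuclideanSpace ℂ n)‖) ''
        Metric.sphere (0 : EuclideanSpace ℂ m) 1 := by
    ext r
    simp [eq_comm]
  unfold sigmaMin
  rw [hs]
  exact h

/-- A set of nodes is a cluster if it is contained in an arc `[a, a + 1/N]` of the circle. -/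
def IsCluster (N : ℕ) (C : Finset UnitAddCircle) : Prop :=
  ∃ a : ℝ, ∀ t ∈ C, ∃ s : ℝ, a ≤ s ∧ s ≤ a + 1 / N ∧ (s : UnitAddCircle) = t

/-- The normalized minimal cluster separation `ρ = N min_{l ≠ l'} dist (Λ l, Λ l')`; it is `∞` if there
is only one cluster. -/
noncomputable def clusterSeparation (N : ℕ) {L : ℕ} (Λ : Fin L → Finset UnitAddCircle) : ENNReal :=
  ⨅ (l : Fin L) (l' : Fin L) (_ : l ≠ l') (t ∈ Λ l) (t' ∈ Λ l'),
    ENNReal.ofReal (N * dist t t')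

/-- `Ω` is a clustered node configuration with the (nonempty) clusters `Λ 0, …, Λ (L - 1)`. -/
structure IsClusteredConfiguration (N : ℕ) (Ω : Finset UnitAddCircle) {L : ℕ}
    (Λ : Fin L → Finset UnitAddCircle) : Prop where
  nonempty : ∀ l, (Λ l).Nonempty
  iUnion_eq : (⋃ l, (Λ l : Set UnitAddCircle)) = (Ω : Set UnitAddCircle)
  isCluster : ∀ l, IsCluster N (Λ l)
  one_lt_separation : 1 < clusterSeparation N Λ

open Classical in
/-- The cluster complexity
`max_{t ∈ Ω} ∏_{t' ∈ Ω, 0 < dist t t' ≤ 1/N} 1 / (N dist t t')`. -/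
noncomputable def clusterComplexity (N : ℕ) (Ω : Finset UnitAddCircle) : ℝ :=
  ⨆ t : Ω, ∏ t' ∈ Ω with 0 < dist (t : UnitAddCircle) t' ∧ dist (t : UnitAddCircle) t' ≤ 1 / N,
    1 / (N * dist (t : UnitAddCircle) t')

/-- The normalized minimal separation `N min_{t ≠ t'} dist t t'` of the nodes. -/
noncomputable def minimalSeparation (N : ℕ) (Ω : Finset UnitAddCircle) : ℝ :=
  N * (Ω : Set UnitAddCircle).infsep

/-- The clustered node configurations with fewer than `N` nodes, normalized minimal separation `τ` and
largest cluster of cardinality `m`, whose cluster separation satisfies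
`ρ ≥ 2 m (2 √2 m ^ m ζ(2) 𝒞) ^ (1/2)`, where `ζ(2) = π² / 6` and `𝒞` is the cluster complexity. -/
noncomputable def admissibleConfigurations (N m : ℕ) (τ : ℝ) : Set (Finset UnitAddCircle) :=
  {Ω | Ω.card < N ∧ minimalSeparation N Ω = τ ∧
    ∃ (L : ℕ) (Λ : Fin L → Finset UnitAddCircle), IsClusteredConfiguration N Ω Λ ∧
      IsGreatest (Set.range fun l => (Λ l).card) m ∧
      ENNReal.ofReal (2 * m *
        √(2 * √2 * (m : ℝ) ^ m * (Real.pi ^ 2 / 6) * clusterComplexity N Ω)) ≤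
          clusterSeparation N Λ}

/-!
Lower bound. With `n ≈ N / (m + 3)`, attach to each node `t` the polynomial `p_t` of degree
below `N` that is the Lagrange basis polynomial of the cluster of `t` in the variable `z ^ n`,
times the fourth power of the Dirichlet kernel of length `n` centred at `t`. If the coefficient
vectors of the `p_t` are the columns of `P`, then `A P` is the matrix of the values `p_s (z_t)`:
it agrees with the identity inside the clusters, and since the fourth power of the kernel is
summable over the other clusters, the threshold for `ρ` makes `‖A P - 1‖ ≤ 1 / 2` by the Schur
test. Hence `σ_min(A) ≥ 1 / (2 ‖P‖)`. The Lagrange factors are bounded by products of inverse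
distances inside a cluster. Such a product over `τ`-separated points gains a factorial, which
cancels the powers of `m` coming from `n ≈ N / (m + 3)` and leaves `(C / τ) ^ (m - 1)` with `C`
absolute. The kernels contribute the factor `1 / √n` to `‖P‖`, where `n` is replaced by `N` at
the price of a factor polynomial in `m`, absorbed into `C`.

Upper bound. For `m` nodes at consecutive distance `τ / N`, `A*` maps the vector of alternating
binomial coefficients to `(m - 1)`-st finite differences, of modulus at most
`(2 π τ) ^ (m - 1)`.

The minimum is attained because configurations with a fixed assignment of indices to clusters
form a closed subset of a torus, and there are finitely many assignments.
-/

section ApproximateRightInverse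

open scoped Matrix.Norms.L2Operator

variable {m n : Type*} [Fintype m] [Fintype n]

theorem sigmaMin_nonneg (A : Matrix m n ℂ) : 0 ≤ sigmaMin A :=
  Real.sInf_nonneg fun _ ⟨_, _, hr⟩ => hr ▸ norm_nonneg _

theorem sigmaMin_mul_norm_le (A : Matrix m n ℂ) (v : EuclideanSpace ℂ m) :
    sigmaMin A * ‖v‖ ≤ ‖(WithLp.toLp 2 (A.conjTranspose.mulVec v.ofLp) : EuclideanSpace ℂ n)‖ := by
  rcases eq_or_ne v 0 with rfl | hv
  · simp
  have hv' : 0 < ‖v‖ := norm_pos_iff.2 hv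
  have hmin : sigmaMin A ≤ ‖v‖⁻¹ *
      ‖(WithLp.toLp 2 (A.conjTranspose.mulVec v.ofLp) : EuclideanSpace ℂ n)‖ := by
    refine csInf_le ⟨0, fun _ ⟨_, _, hr⟩ => hr ▸ norm_nonneg _⟩
      ⟨((‖v‖⁻¹ : ℝ) : ℂ) • v, ?_, ?_⟩
    · rw [norm_smul, Complex.norm_real, norm_inv, norm_norm, inv_mul_cancel₀ hv'.ne']
    · rw [WithLp.ofLp_smul, Matrix.mulVec_smul, WithLp.toLp_smul, norm_smul, Complex.norm_real,
        norm_inv, norm_norm]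
  rwa [← le_div_iff₀ hv', div_eq_inv_mul]

theorem le_sigmaMin [Nonempty m] {A : Matrix m n ℂ} {c : ℝ}
    (h : ∀ v : EuclideanSpace ℂ m,
      c * ‖v‖ ≤ ‖(WithLp.toLp 2 (A.conjTranspose.mulVec v.ofLp) : EuclideanSpace ℂ n)‖) :
    c ≤ sigmaMin A := by
  obtain ⟨v, hv, hσ⟩ := (sigmaMin_isLeast A).1
  simpa [hv, ← hσ] using h v

/-- The Schur test. -/
theorem l2_opNorm_le_of_sum_norm_le [DecidableEq n] {E : Matrix m n ℂ} {b : ℝ} (hb : 0 ≤ b)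
    (hrow : ∀ i, ∑ j, ‖E i j‖ ≤ b) (hcol : ∀ j, ∑ i, ‖E i j‖ ≤ b) : ‖E‖ ≤ b := by
  rw [Matrix.l2_opNorm_def]
  refine ContinuousLinearMap.opNorm_le_bound _ hb fun v => ?_
  have hentry (i : m) : ‖E.mulVec v.ofLp i‖ ^ 2 ≤ b * ∑ j, ‖E i j‖ * ‖v j‖ ^ 2 :=
    calc ‖E.mulVec v.ofLp i‖ ^ 2 ≤ (∑ j, ‖E i j‖ * ‖v j‖) ^ 2 := by
          gcongr
          exact (norm_sum_le _ _).trans_eq (by simp only [norm_mul])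
      _ ≤ (∑ j, ‖E i j‖) * ∑ j, ‖E i j‖ * ‖v j‖ ^ 2 :=
          Finset.sum_sq_le_sum_mul_sum_of_sq_le_mul _ (fun _ _ => norm_nonneg _)
            (fun _ _ => by positivity) fun _ _ => (by ring : _ = _).le
      _ ≤ b * ∑ j, ‖E i j‖ * ‖v j‖ ^ 2 := by
          gcongr
          exact hrow i
  refine le_of_sq_le_sq ?_ (by positivity)
  calc _ = ∑ i, ‖E.mulVec v.ofLp i‖ ^ 2 := EuclideanSpace.norm_sq_eq _
    _ ≤ ∑ i, b * ∑ j, ‖E i j‖ * ‖v j‖ ^ 2 := Finset.sum_le_sum fun i _ => hentry i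
    _ = b * ∑ j, (∑ i, ‖E i j‖) * ‖v j‖ ^ 2 := by
        rw [← Finset.mul_sum, Finset.sum_comm]
        simp only [Finset.sum_mul]
    _ ≤ b * ∑ j, b * ‖v j‖ ^ 2 := by
        gcongr with j
        exact hcol j
    _ = (b * ‖v‖) ^ 2 := by
        rw [← Finset.mul_sum, ← EuclideanSpace.norm_sq_eq]
        ring

theorem l2_norm_conjTranspose_mulVec_le [DecidableEq n] (A : Matrix m n ℂ)
    (v : EuclideanSpace ℂ m) :
    ‖(WithLp.toLp 2 (A.conjTranspose.mulVec v.ofLp) : EuclideanSpace ℂ n)‖ ≤ ‖A‖ * ‖v‖ := by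
  classical
  rw [← Matrix.l2_opNorm_conjTranspose]
  exact Matrix.l2_opNorm_mulVec A.conjTranspose v

theorem one_le_two_mul_mul_sigmaMin [DecidableEq m] [Nonempty m] {A : Matrix m n ℂ}
    {P : Matrix n m ℂ} {K : ℝ} (hK : 0 < K) (hP : ‖P‖ ≤ K) (hAP : ‖A * P - 1‖ ≤ 1 / 2) :
    1 ≤ 2 * K * sigmaMin A := by
  suffices h : 1 / (2 * K) ≤ sigmaMin A by
    rwa [div_le_iff₀ (by positivity), mul_comm] at h
  refine le_sigmaMin fun v => ?_
  set w : EuclideanSpace ℂ n := WithLp.toLp 2 (A.conjTranspose.mulVec v.ofLp) with hw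
  have hsplit : v = WithLp.toLp 2 (P.conjTranspose.mulVec w.ofLp) -
      WithLp.toLp 2 ((A * P - 1).conjTranspose.mulVec v.ofLp) := by
    simp [hw, Matrix.conjTranspose_sub, Matrix.sub_mulVec, Matrix.conjTranspose_mul,
      Matrix.mulVec_mulVec]
  have hnorm : ‖v‖ ≤ K * ‖w‖ + 1 / 2 * ‖v‖ :=
    calc ‖v‖ ≤ _ := (congrArg norm hsplit).trans_le (norm_sub_le _ _)
      _ ≤ ‖P‖ * ‖w‖ + ‖A * P - 1‖ * ‖v‖ :=
        add_le_add (l2_norm_conjTranspose_mulVec_le P w) (l2_norm_conjTranspose_mulVec_le _ v)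
      _ ≤ K * ‖w‖ + 1 / 2 * ‖v‖ := by gcongr
  rw [div_mul_eq_mul_div, one_mul, div_le_iff₀ (by positivity)]
  linarith

end ApproximateRightInverse

section Circle

theorem exists_coe_eq_norm_eq_abs (y : UnitAddCircle) :
    ∃ r : ℝ, (r : UnitAddCircle) = y ∧ ‖y‖ = |r| := by
  obtain ⟨r, rfl⟩ := QuotientAddGroup.mk_surjective y
  refine ⟨r - round r, ?_, UnitAddCircle.norm_eq⟩
  have h : ((round r : ℝ) : UnitAddCircle) = 0 :=
    (AddCircle.coe_eq_zero_iff 1).2 ⟨round r, by simp⟩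
  change ((r - round r : ℝ) : UnitAddCircle) = (r : UnitAddCircle)
  rw [AddCircle.coe_sub, h, sub_zero]

theorem norm_coe_unitAddCircle_of_abs_le {x : ℝ} (hx : |x| ≤ 1 / 2) :
    ‖(x : UnitAddCircle)‖ = |x| := by
  rw [AddCircle.norm_coe_eq_abs_iff _ one_ne_zero]
  simpa using hx

theorem norm_coe_unitAddCircle_le_abs (x : ℝ) : ‖(x : UnitAddCircle)‖ ≤ |x| := by
  rw [UnitAddCircle.norm_eq]
  simpa using round_le x 0

theorem norm_unitAddCircle_le_half (y : UnitAddCircle) : ‖y‖ ≤ 1 / 2 := by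
  simpa using AddCircle.norm_le_half_period 1 one_ne_zero (x := y)

theorem norm_nsmul_unitAddCircle {n : ℕ} {y : UnitAddCircle} (h : n * ‖y‖ ≤ 1 / 2) :
    ‖n • y‖ = n * ‖y‖ := by
  obtain ⟨r, rfl, hr⟩ := exists_coe_eq_norm_eq_abs y
  have habs : |n • r| = n * |r| := by rw [nsmul_eq_mul, abs_mul, Nat.abs_cast]
  rw [hr, ← habs] at h
  rw [← AddCircle.coe_nsmul, norm_coe_unitAddCircle_of_abs_le h, habs, hr]

theorem exists_signedCoordinate (x : UnitAddCircle) :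
    ∃ r : UnitAddCircle → ℝ, (∀ s, dist x s = |r s|) ∧ ∀ s s', dist s s' ≤ |r s - r s'| := by
  choose r hr hnorm using fun s => exists_coe_eq_norm_eq_abs (s - x)
  refine ⟨r, fun s => by rw [dist_comm, dist_eq_norm, hnorm], fun s s' => ?_⟩
  have hsub : s - s' = ((r s - r s' : ℝ) : UnitAddCircle) := by
    rw [AddCircle.coe_sub, hr, hr, sub_sub_sub_cancel_right]
  exact dist_eq_norm s s' ▸ hsub ▸ norm_coe_unitAddCircle_le_abs _

theorem four_mul_norm_le_norm_toCircle_sub_one (y : UnitAddCircle) :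
    4 * ‖y‖ ≤ ‖(AddCircle.toCircle y : ℂ) - 1‖ := by
  obtain ⟨r, rfl, hr⟩ := exists_coe_eq_norm_eq_abs y
  have hhalf : |r| ≤ 1 / 2 := hr ▸ norm_unitAddCircle_le_half _
  have harg : |Real.pi * r| = Real.pi * |r| := by rw [abs_mul, abs_of_pos Real.pi_pos]
  have hsin := Real.mul_abs_le_abs_sin (x := Real.pi * r) (by rw [harg]; nlinarith [Real.pi_pos])
  rw [AddCircle.toCircle_apply_mk, Circle.coe_exp, mul_comm _ Complex.I,
    Complex.norm_exp_I_mul_ofReal_sub_one, norm_mul, Real.norm_eq_abs, Real.norm_eq_abs, abs_two,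
    show 2 * Real.pi / 1 * r / 2 = Real.pi * r by ring, hr]
  have hcancel : 2 / Real.pi * (Real.pi * |r|) = 2 * |r| := by field_simp
  rw [harg, hcancel] at hsin
  linarith

theorem coe_toCircle_sub (x y : UnitAddCircle) :
    (AddCircle.toCircle (x - y) : ℂ) =
      AddCircle.toCircle x * (starRingEnd ℂ) (AddCircle.toCircle y) := by
  rw [sub_eq_add_neg, AddCircle.toCircle_add, AddCircle.toCircle_neg, Circle.coe_mul,
    Circle.coe_inv_eq_conj]

theorem exists_coe_toCircle_eq {z : ℂ} (hz : ‖z‖ = 1) :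
    ∃ x : UnitAddCircle, (AddCircle.toCircle x : ℂ) = z := by
  refine ⟨((z.arg / (2 * Real.pi) : ℝ) : UnitAddCircle), ?_⟩
  have hpolar := Complex.norm_mul_exp_arg_mul_I z
  rw [hz, Complex.ofReal_one, one_mul] at hpolar
  rw [AddCircle.toCircle_apply_mk, Circle.coe_exp, div_one,
    mul_div_cancel₀ _ Real.two_pi_pos.ne', hpolar]

theorem four_mul_dist_le_norm_toCircle_sub (x y : UnitAddCircle) :
    4 * dist x y ≤ ‖(AddCircle.toCircle x : ℂ) - AddCircle.toCircle y‖ := by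
  have hfactor : (AddCircle.toCircle x : ℂ) - AddCircle.toCircle y =
      (AddCircle.toCircle (x - y) - 1) * AddCircle.toCircle y := by
    rw [sub_mul, one_mul, ← Circle.coe_mul, ← AddCircle.toCircle_add, sub_add_cancel]
  rw [hfactor, norm_mul, Circle.norm_coe, mul_one, dist_eq_norm]
  exact four_mul_norm_le_norm_toCircle_sub_one _

theorem four_mul_dist_le_norm_toCircle_pow_sub_pow {n : ℕ} {x y : UnitAddCircle}
    (h : n * dist x y ≤ 1 / 2) :
    4 * (n * dist x y) ≤ ‖(AddCircle.toCircle x : ℂ) ^ n - (AddCircle.toCircle y : ℂ) ^ n‖ := by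
  have hdist : dist (n • x) (n • y) = n * dist x y := by
    rw [dist_eq_norm, ← nsmul_sub, norm_nsmul_unitAddCircle (by rwa [← dist_eq_norm]),
      ← dist_eq_norm]
  rw [← hdist, ← Circle.coe_pow, ← Circle.coe_pow, ← AddCircle.toCircle_nsmul,
    ← AddCircle.toCircle_nsmul]
  exact four_mul_dist_le_norm_toCircle_sub _ _

end Circle

section Packing

theorem sum_one_div_pow_four_le_two (J : Finset ℕ) : ∑ j ∈ J, (1 / (j : ℝ)) ^ 4 ≤ 2 := by
  calc ∑ j ∈ J, (1 / (j : ℝ)) ^ 4 = ∑ j ∈ J, 1 / (j : ℝ) ^ 4 := by simp only [one_div, inv_pow]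
    _ ≤ Real.pi ^ 4 / 90 := sum_le_hasSum _ (fun _ _ => by positivity) hasSum_zeta_four
    _ ≤ 3.15 ^ 4 / 90 := by
        gcongr
        exact Real.pi_lt_d2.le
    _ ≤ 2 := by norm_num

/-- Among the points of `Ω`, at most `m` have pairwise distances below `δ`: the sparsity of a union
of separated clusters, in the form in which it bounds sums of decaying functions over `Ω`. -/
def IsPacked {X : Type*} [PseudoMetricSpace X] (m : ℕ) (δ : ℝ) (Ω : Finset X) : Prop :=
  ∀ T ⊆ Ω, (∀ s ∈ T, ∀ s' ∈ T, dist s s' < δ) → T.card ≤ m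

namespace IsPacked

variable {X : Type*} [PseudoMetricSpace X] {m : ℕ} {δ : ℝ} {Ω S : Finset X}

theorem subset (hΩ : IsPacked m δ Ω) (hS : S ⊆ Ω) : IsPacked m δ S :=
  fun T hT => hΩ T (hT.trans hS)

theorem card_le_of_mem_Ico (hΩ : IsPacked m δ Ω) {f : X → ℝ}
    (hf : ∀ s s', dist s s' ≤ |f s - f s'|) {a : ℝ} (ha : ∀ s ∈ Ω, f s ∈ Set.Ico a (a + δ)) :
    Ω.card ≤ m := by
  refine hΩ Ω subset_rfl fun s hs s' hs' => (hf s s').trans_lt ?_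
  rw [abs_lt]
  constructor <;> linarith [(ha s hs).1, (ha s hs).2, (ha s' hs').1, (ha s' hs').2]

theorem sum_div_pow_four_le_of_le (hΩ : IsPacked m δ Ω) (hδ : 0 < δ) {f : X → ℝ}
    (hf : ∀ s s', dist s s' ≤ |f s - f s'|) (hfδ : ∀ s ∈ Ω, δ ≤ f s) :
    ∑ s ∈ Ω, (δ / f s) ^ 4 ≤ 2 * m := by
  classical
  have hfiber (k : ℕ) :
      ∑ s ∈ Ω with ⌊f s / δ⌋₊ = k, (δ / f s) ^ 4 ≤ m * (1 / (k : ℝ)) ^ 4 := by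
    have hbounds : ∀ s ∈ Ω.filter (⌊f · / δ⌋₊ = k), 0 < (k : ℝ) ∧ k * δ ≤ f s ∧
        f s < k * δ + δ := by
      intro s hs
      rw [Finset.mem_filter] at hs
      have hone : 1 ≤ f s / δ := (one_le_div hδ).2 (hfδ s hs.1)
      obtain ⟨hlow, hup⟩ := (Nat.floor_eq_iff (zero_le_one.trans hone)).1 hs.2
      refine ⟨Nat.cast_pos.2 (hs.2 ▸ Nat.floor_pos.2 hone), (le_div_iff₀ hδ).1 hlow, ?_⟩
      linarith [(div_lt_iff₀ hδ).1 hup]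
    have hcard := (hΩ.subset (Finset.filter_subset _ _)).card_le_of_mem_Ico hf fun s hs =>
      (hbounds s hs).2
    refine (Finset.sum_le_card_nsmul _ _ ((1 / (k : ℝ)) ^ 4) fun s hs => ?_).trans ?_
    · obtain ⟨hk, hlow, -⟩ := hbounds s hs
      have hfs : 0 < f s := (mul_pos hk hδ).trans_le hlow
      gcongr ?_ ^ 4
      rw [div_le_div_iff₀ hfs hk]
      linarith
    · rw [nsmul_eq_mul]
      gcongr
  calc ∑ s ∈ Ω, (δ / f s) ^ 4
      = ∑ k ∈ Ω.image (⌊f · / δ⌋₊), ∑ s ∈ Ω with ⌊f s / δ⌋₊ = k, (δ / f s) ^ 4 :=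
        (Finset.sum_fiberwise_of_maps_to (fun s hs => Finset.mem_image_of_mem _ hs) _).symm
    _ ≤ ∑ k ∈ Ω.image (⌊f · / δ⌋₊), m * (1 / (k : ℝ)) ^ 4 := Finset.sum_le_sum fun k _ => hfiber k
    _ ≤ m * 2 := by
        rw [← Finset.mul_sum]
        gcongr
        exact sum_one_div_pow_four_le_two _
    _ = 2 * m := mul_comm _ _

variable {Ω : Finset UnitAddCircle}

theorem card_le_of_dist_lt (hΩ : IsPacked m δ Ω) {x : UnitAddCircle}
    (hx : ∀ s ∈ Ω, dist x s < δ) : Ω.card ≤ 2 * m := by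
  obtain ⟨r, hr, hdist⟩ := exists_signedCoordinate x
  have hright : (Ω.filter fun s => 0 ≤ r s).card ≤ m := by
    refine (hΩ.subset (Finset.filter_subset _ _)).card_le_of_mem_Ico hdist (a := 0) fun s hs => ?_
    rw [Finset.mem_filter] at hs
    exact ⟨hs.2, by linarith [(abs_lt.1 (hr s ▸ hx s hs.1)).2]⟩
  have hleft : (Ω.filter fun s => ¬ 0 ≤ r s).card ≤ m := by
    refine (hΩ.subset (Finset.filter_subset _ _)).card_le_of_mem_Ico hdist (a := -δ) fun s hs => ?_
    rw [Finset.mem_filter] at hs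
    exact ⟨(abs_lt.1 (hr s ▸ hx s hs.1)).1.le, by linarith [not_le.1 hs.2]⟩
  rw [← Finset.card_filter_add_card_filter_not (s := Ω) fun s => 0 ≤ r s]
  omega

theorem sum_div_dist_pow_four_le (hΩ : IsPacked m δ Ω) (hδ : 0 < δ) {x : UnitAddCircle}
    (hx : ∀ s ∈ Ω, δ ≤ dist x s) : ∑ s ∈ Ω, (δ / dist x s) ^ 4 ≤ 4 * m := by
  obtain ⟨r, hr, hdist⟩ := exists_signedCoordinate x
  have hright : ∑ s ∈ Ω with 0 ≤ r s, (δ / dist x s) ^ 4 ≤ 2 * m := by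
    have habs : ∀ s ∈ Ω.filter (0 ≤ r ·), dist x s = r s := fun s hs => by
      rw [hr, abs_of_nonneg (Finset.mem_filter.1 hs).2]
    rw [Finset.sum_congr rfl fun s hs => by rw [habs s hs]]
    exact (hΩ.subset (Finset.filter_subset _ _)).sum_div_pow_four_le_of_le hδ hdist fun s hs =>
      habs s hs ▸ hx s (Finset.mem_filter.1 hs).1
  have hleft : ∑ s ∈ Ω with ¬ 0 ≤ r s, (δ / dist x s) ^ 4 ≤ 2 * m := by
    have habs : ∀ s ∈ Ω.filter (¬ 0 ≤ r ·), dist x s = -r s := fun s hs => by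
      rw [hr, abs_of_neg (not_le.1 (Finset.mem_filter.1 hs).2)]
    rw [Finset.sum_congr rfl fun s hs => by rw [habs s hs]]
    exact (hΩ.subset (Finset.filter_subset _ _)).sum_div_pow_four_le_of_le (f := -r) hδ
      (fun s s' => by simpa [neg_add_eq_sub, abs_sub_comm] using hdist s s') fun s hs =>
        (hx s (Finset.mem_filter.1 hs).1).trans_eq (habs s hs)
  rw [← Finset.sum_filter_add_sum_filter_not Ω fun s => 0 ≤ r s]
  linarith

theorem sum_le_of_decay (hΩ : IsPacked m δ Ω) (hδ : 0 < δ) {x : UnitAddCircle}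
    {F : UnitAddCircle → ℝ} (hF : ∀ s ∈ Ω, F s ≤ 1)
    (hdecay : ∀ s ∈ Ω, δ ≤ dist x s → F s ≤ (δ / dist x s) ^ 4) : ∑ s ∈ Ω, F s ≤ 6 * m := by
  classical
  have hnear : ∑ s ∈ Ω with dist x s < δ, F s ≤ 2 * m := by
    have hcard : (Ω.filter (dist x · < δ)).card ≤ 2 * m :=
      (hΩ.subset (Finset.filter_subset _ _)).card_le_of_dist_lt fun s hs =>
        (Finset.mem_filter.1 hs).2
    refine (Finset.sum_le_card_nsmul _ _ 1 fun s hs => hF s (Finset.mem_filter.1 hs).1).trans ?_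
    rw [nsmul_eq_mul, mul_one]
    exact_mod_cast hcard
  have hfar : ∑ s ∈ Ω with ¬ dist x s < δ, F s ≤ 4 * m := by
    have hle : ∀ s ∈ Ω.filter (¬ dist x · < δ), δ ≤ dist x s := fun s hs =>
      not_lt.1 (Finset.mem_filter.1 hs).2
    exact (Finset.sum_le_sum fun s hs =>
      hdecay s (Finset.mem_filter.1 hs).1 (hle s hs)).trans
        ((hΩ.subset (Finset.filter_subset _ _)).sum_div_dist_pow_four_le hδ hle)
  rw [← Finset.sum_filter_add_sum_filter_not Ω fun s => dist x s < δ]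
  linarith

end IsPacked

end Packing

section Dirichlet

open Polynomial Real

theorem sum_norm_sq_coeff_eq_circleAverage {p : ℂ[X]} {N : ℕ} (hp : p.natDegree < N) :
    ∑ k : Fin N, ‖p.coeff k‖ ^ 2 = circleAverage (fun z => ‖p.eval z‖ ^ 2) 0 1 := by
  rw [← sum_sq_norm_coeff_eq_circleAverage, Fin.sum_univ_eq_sum_range fun k => ‖p.coeff k‖ ^ 2]
  refine (Finset.sum_subset (fun k hk => Finset.mem_range.2 ?_) fun k _ hk => ?_).symm
  · exact (le_natDegree_of_mem_supp k hk).trans_lt hp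
  · rw [notMem_support_iff.1 hk, norm_zero, zero_pow two_ne_zero]

/-- The normalized Dirichlet kernel `(1/n) ∑_{k < n} e^{2πik(x - t)}` centred at the node `t`, as a
polynomial in `z = e^{2πix}`. -/
noncomputable def dirichletPolynomial (n : ℕ) (t : UnitAddCircle) : ℂ[X] :=
  ∑ k ∈ Finset.range n, monomial k ((n : ℂ)⁻¹ * (starRingEnd ℂ) (AddCircle.toCircle t : ℂ) ^ k)

variable {n : ℕ}

theorem natDegree_dirichletPolynomial_le (n : ℕ) (t : UnitAddCircle) :
    (dirichletPolynomial n t).natDegree ≤ n - 1 :=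
  natDegree_sum_le_of_forall_le _ _ fun _ hk =>
    (natDegree_monomial_le _).trans (Nat.le_sub_one_of_lt (Finset.mem_range.1 hk))

theorem coeff_dirichletPolynomial {k : ℕ} (hk : k < n) (t : UnitAddCircle) :
    (dirichletPolynomial n t).coeff k =
      (n : ℂ)⁻¹ * (starRingEnd ℂ) (AddCircle.toCircle t : ℂ) ^ k := by
  simp [dirichletPolynomial, finsetSum_coeff, coeff_monomial, hk]

theorem eval_dirichletPolynomial (n : ℕ) (t x : UnitAddCircle) :
    (dirichletPolynomial n t).eval (AddCircle.toCircle x : ℂ) =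
      (n : ℂ)⁻¹ * ∑ k ∈ Finset.range n, (AddCircle.toCircle (x - t) : ℂ) ^ k := by
  rw [dirichletPolynomial, eval_finsetSum, Finset.mul_sum]
  refine Finset.sum_congr rfl fun k _ => ?_
  rw [eval_monomial, coe_toCircle_sub, mul_pow]
  ring

theorem eval_dirichletPolynomial_self (hn : 0 < n) (t : UnitAddCircle) :
    (dirichletPolynomial n t).eval (AddCircle.toCircle t : ℂ) = 1 := by
  simp [eval_dirichletPolynomial, hn.ne']

theorem norm_eval_dirichletPolynomial_le_one (n : ℕ) (t x : UnitAddCircle) :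
    ‖(dirichletPolynomial n t).eval (AddCircle.toCircle x : ℂ)‖ ≤ 1 := by
  rw [eval_dirichletPolynomial, norm_mul, norm_inv, Complex.norm_natCast]
  refine inv_mul_le_one_of_le₀ ((norm_sum_le _ _).trans_eq ?_) n.cast_nonneg
  simp only [norm_pow, Circle.norm_coe, one_pow, Finset.sum_const, Finset.card_range, nsmul_eq_mul,
    mul_one]

theorem norm_eval_dirichletPolynomial_le {t x : UnitAddCircle} (hx : x ≠ t) :
    ‖(dirichletPolynomial n t).eval (AddCircle.toCircle x : ℂ)‖ ≤ 1 / (2 * n * dist x t) := by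
  have hd : 0 < dist x t := dist_pos.2 hx
  have hlow := four_mul_norm_le_norm_toCircle_sub_one (x - t)
  rw [← dist_eq_norm] at hlow
  have hw : (AddCircle.toCircle (x - t) : ℂ) ≠ 1 := fun h => by
    rw [h, sub_self, norm_zero] at hlow
    linarith
  have hup : ‖(AddCircle.toCircle (x - t) : ℂ) ^ n - 1‖ ≤ 2 := by
    refine (norm_sub_le _ _).trans_eq ?_
    rw [norm_pow, Circle.norm_coe, one_pow, norm_one]
    norm_num
  rw [eval_dirichletPolynomial, geom_sum_eq hw, norm_mul, norm_inv, Complex.norm_natCast, norm_div]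
  calc _ ≤ (n : ℝ)⁻¹ * (2 / (4 * dist x t)) := by gcongr
    _ = 1 / (2 * n * dist x t) := by
      field_simp
      norm_num

theorem circleAverage_norm_sq_dirichletPolynomial (hn : 0 < n) (t : UnitAddCircle) :
    circleAverage (fun z => ‖(dirichletPolynomial n t).eval z‖ ^ 2) 0 1 = 1 / n := by
  have hn' : (n : ℝ) ≠ 0 := by exact_mod_cast hn.ne'
  have hcoeff (k : Fin n) : ‖(dirichletPolynomial n t).coeff k‖ ^ 2 = ((n : ℝ)⁻¹) ^ 2 := by
    rw [coeff_dirichletPolynomial k.is_lt, norm_mul, norm_pow, RCLike.norm_conj, Circle.norm_coe,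
      one_pow, mul_one, norm_inv, Complex.norm_natCast]
  rw [← sum_norm_sq_coeff_eq_circleAverage
    ((natDegree_dirichletPolynomial_le n t).trans_lt (Nat.sub_one_lt hn.ne'))]
  simp only [hcoeff, Finset.sum_const, Finset.card_univ, Fintype.card_fin, nsmul_eq_mul]
  field_simp

end Dirichlet

section LocalizedPolynomial

open Polynomial

variable {n : ℕ} {K : Finset UnitAddCircle} {t s : UnitAddCircle}

open Classical in
/-- The polynomial that is `1` at the node `t`, vanishes at the other nodes of `K` and is localized
around `t`: a Lagrange basis polynomial in `z ^ n` times the fourth power of a Dirichlet kernel. -/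
noncomputable def localizedPolynomial (n : ℕ) (K : Finset UnitAddCircle) (t : UnitAddCircle) :
    ℂ[X] :=
  expand ℂ n (Lagrange.basis K (fun s => (AddCircle.toCircle s : ℂ) ^ n) t) *
    dirichletPolynomial n t ^ 4

open Classical in
/-- The bound `∏_{s ∈ K, s ≠ t} 1 / (2 n dist t s)` on the unit circle for the Lagrange basis
polynomial of `K` at `t` in the variable `z ^ n`. -/
noncomputable def nodalBound (n : ℕ) (K : Finset UnitAddCircle) (t : UnitAddCircle) : ℝ :=
  ∏ s ∈ K.erase t, 1 / (2 * n * dist t s)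

theorem toCircle_pow_injOn (hn : 0 < n) (hK : ∀ s ∈ K, ∀ s' ∈ K, n * dist s s' ≤ 1 / 2) :
    Set.InjOn (fun s : UnitAddCircle => (AddCircle.toCircle s : ℂ) ^ n) K := by
  intro s hs s' hs' heq
  have hdist := four_mul_dist_le_norm_toCircle_pow_sub_pow (hK s hs s' hs')
  rw [sub_eq_zero.2 heq, norm_zero] at hdist
  have hn' : (0 : ℝ) < n := by exact_mod_cast hn
  exact dist_le_zero.1 (by nlinarith)

theorem natDegree_localizedPolynomial_lt {m N : ℕ} (hn : 0 < n) (hN : (m + 3) * n ≤ N)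
    (hK : ∀ s ∈ K, ∀ s' ∈ K, n * dist s s' ≤ 1 / 2) (ht : t ∈ K) (hcard : K.card ≤ m) :
    (localizedPolynomial n K t).natDegree < N := by
  have hbound : (localizedPolynomial n K t).natDegree ≤ (K.card - 1) * n + 4 * (n - 1) := by
    refine natDegree_mul_le.trans (add_le_add ?_ (natDegree_pow_le.trans ?_))
    · rw [natDegree_expand, Lagrange.natDegree_basis (toCircle_pow_injOn hn hK) ht]
    · exact Nat.mul_le_mul_left _ (natDegree_dirichletPolynomial_le n t)
  obtain ⟨k, rfl⟩ : ∃ k, m = k + 1 :=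
    Nat.exists_eq_add_of_le' ((Finset.card_pos.2 ⟨t, ht⟩).trans_le hcard)
  have hmul : (K.card - 1) * n ≤ k * n := Nat.mul_le_mul_right _ (by omega)
  have hexp : (k + 1 + 3) * n = k * n + 4 * n := by ring
  omega

theorem eval_localizedPolynomial_self (hn : 0 < n)
    (hK : ∀ s ∈ K, ∀ s' ∈ K, n * dist s s' ≤ 1 / 2) (ht : t ∈ K) :
    (localizedPolynomial n K t).eval (AddCircle.toCircle t : ℂ) = 1 := by
  rw [localizedPolynomial, eval_mul, expand_eval, eval_pow, eval_dirichletPolynomial_self hn,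
    one_pow, mul_one]
  exact Lagrange.eval_basis_self (toCircle_pow_injOn hn hK) ht

theorem eval_localizedPolynomial_of_ne (n : ℕ) (hs : s ∈ K) (hst : s ≠ t) :
    (localizedPolynomial n K t).eval (AddCircle.toCircle s : ℂ) = 0 := by
  rw [localizedPolynomial, eval_mul, expand_eval]
  exact mul_eq_zero_of_left
    (Lagrange.eval_basis_of_ne (v := fun s => (AddCircle.toCircle s : ℂ) ^ n) hst.symm hs) _

theorem norm_eval_localizedPolynomial_le (hn : 0 < n) (hK : ∀ s ∈ K, n * dist t s ≤ 1 / 2)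
    (x : UnitAddCircle) :
    ‖(localizedPolynomial n K t).eval (AddCircle.toCircle x : ℂ)‖ ≤
      nodalBound n K t * ‖(dirichletPolynomial n t).eval (AddCircle.toCircle x : ℂ)‖ ^ 4 := by
  classical
  have : (0 : ℝ) < n := by exact_mod_cast hn
  rw [localizedPolynomial, eval_mul, expand_eval, eval_pow, norm_mul, norm_pow, Lagrange.basis,
    eval_prod, norm_prod]
  refine mul_le_mul_of_nonneg_right
    (Finset.prod_le_prod (fun _ _ => norm_nonneg _) fun s hs => ?_) (by positivity)
  obtain ⟨hst, hsK⟩ := Finset.mem_erase.1 hs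
  have hdist : 0 < dist t s := dist_pos.2 (Ne.symm hst)
  have hlow := four_mul_dist_le_norm_toCircle_pow_sub_pow (hK s hsK)
  have hup : ‖(AddCircle.toCircle x : ℂ) ^ n - (AddCircle.toCircle s : ℂ) ^ n‖ ≤ 2 := by
    refine (norm_sub_le _ _).trans_eq ?_
    rw [norm_pow, norm_pow, Circle.norm_coe, Circle.norm_coe, one_pow]
    norm_num
  rw [Lagrange.basisDivisor, eval_mul, eval_C, eval_sub, eval_X, eval_C, norm_mul, norm_inv]
  calc _ ≤ (4 * (n * dist t s))⁻¹ * 2 := by gcongr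
    _ = 1 / (2 * n * dist t s) := by
      field_simp
      norm_num

end LocalizedPolynomial

/-- `cl t` is the cluster of the node `t ∈ Ω`: the clusters have at most `m` nodes and diameter at
most `r`, and the nodes outside `cl t` have distance at least `δ` from `t`. -/
structure IsClusterMap {X : Type*} [PseudoMetricSpace X] (Ω : Finset X) (m : ℕ) (r δ : ℝ)
    (cl : X → Finset X) : Prop where
  mem_self : ∀ t ∈ Ω, t ∈ cl t
  subset : ∀ t ∈ Ω, cl t ⊆ Ω
  card_le : ∀ t ∈ Ω, (cl t).card ≤ m
  dist_le : ∀ t ∈ Ω, ∀ s ∈ cl t, ∀ s' ∈ cl t, dist s s' ≤ r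
  le_dist : ∀ t ∈ Ω, ∀ s ∈ Ω, s ∉ cl t → δ ≤ dist t s

theorem IsClusterMap.isPacked {X : Type*} [PseudoMetricSpace X] {Ω : Finset X} {m : ℕ} {r δ : ℝ}
    {cl : X → Finset X} (hcl : IsClusterMap Ω m r δ cl) : IsPacked m δ Ω := by
  intro T hT hclose
  obtain rfl | ⟨t, ht⟩ := T.eq_empty_or_nonempty
  · simp
  refine (Finset.card_le_card fun s hs => ?_).trans (hcl.card_le t (hT ht))
  by_contra hs'
  exact (hclose t ht s hs).not_ge (hcl.le_dist t (hT ht) s (hT hs) hs')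

section CoefficientMatrix

open Polynomial Real
open scoped Matrix.Norms.L2Operator

/-- The matrix whose columns are the coefficient vectors of the polynomials `p s`, `s ∈ Ω`, of
degree less than `N`. -/
def coefficientMatrix (N : ℕ) (Ω : Finset UnitAddCircle) (p : UnitAddCircle → ℂ[X]) :
    Matrix (Fin N) Ω ℂ :=
  Matrix.of fun k s => (p s).coeff k

variable {N m n : ℕ} {Ω : Finset UnitAddCircle} {p : UnitAddCircle → ℂ[X]} {r δ B : ℝ}

theorem vandermondeMatrix_mul_coefficientMatrix (hp : ∀ s ∈ Ω, (p s).natDegree < N) (t s : Ω) :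
    (vandermondeMatrix N Ω * coefficientMatrix N Ω p) t s =
      (p s).eval (AddCircle.toCircle (t : UnitAddCircle) : ℂ) := by
  rw [Matrix.mul_apply, eval_eq_sum_range' (hp s s.2), ← Fin.sum_univ_eq_sum_range fun k =>
    (p s).coeff k * (AddCircle.toCircle (t : UnitAddCircle) : ℂ) ^ k]
  exact Finset.sum_congr rfl fun k _ => mul_comm _ _

theorem norm_sq_coefficientMatrix_mulVec (hp : ∀ s ∈ Ω, (p s).natDegree < N)
    (v : EuclideanSpace ℂ Ω) :
    ‖(WithLp.toLp 2 ((coefficientMatrix N Ω p).mulVec v.ofLp) : EuclideanSpace ℂ (Fin N))‖ ^ 2 =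
      circleAverage (fun z => ‖∑ s : Ω, v s * (p s).eval z‖ ^ 2) 0 1 := by
  rcases isEmpty_or_nonempty Ω with hΩ | ⟨⟨s₀, hs₀⟩⟩
  · simp [EuclideanSpace.norm_sq_eq, Matrix.mulVec, dotProduct, circleAverage_const]
  have hdeg : (∑ s : Ω, C (v s) * p s).natDegree < N :=
    Nat.lt_of_le_sub_one (Nat.zero_lt_of_lt (hp s₀ hs₀)) <|
      natDegree_sum_le_of_forall_le _ _ fun s _ =>
        (natDegree_C_mul_le _ _).trans (Nat.le_sub_one_of_lt (hp s s.2))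
  simpa [EuclideanSpace.norm_sq_eq, Matrix.mulVec, dotProduct, coefficientMatrix, mul_comm,
    finsetSum_coeff, eval_finsetSum] using sum_norm_sq_coeff_eq_circleAverage hdeg

theorem norm_sq_sum_mul_eval_le (hn : 0 < n) (hδ : 1 / (2 * n) ≤ δ) (hΩ : IsPacked m δ Ω)
    (hp : ∀ s ∈ Ω, ∀ x : UnitAddCircle, ‖(p s).eval (AddCircle.toCircle x : ℂ)‖ ≤
      B * ‖(dirichletPolynomial n s).eval (AddCircle.toCircle x : ℂ)‖ ^ 4)
    (v : Ω → ℂ) (x : UnitAddCircle) :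
    ‖∑ s : Ω, v s * (p s).eval (AddCircle.toCircle x : ℂ)‖ ^ 2 ≤ 6 * m * B ^ 2 *
      ∑ s : Ω, ‖v s‖ ^ 2 * ‖(dirichletPolynomial n s).eval (AddCircle.toCircle x : ℂ)‖ ^ 2 := by
  set κ : UnitAddCircle → ℝ := fun s =>
    ‖(dirichletPolynomial n s).eval (AddCircle.toCircle x : ℂ)‖
  have hκ_nonneg (s) : 0 ≤ κ s := norm_nonneg _
  have hκ_le_one (s) : κ s ≤ 1 := norm_eval_dirichletPolynomial_le_one n s x
  have : (0 : ℝ) < n := by exact_mod_cast hn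
  have hδ_pos : 0 < δ := lt_of_lt_of_le (by positivity) hδ
  have hdecay : ∑ s : Ω, κ s ^ 4 ≤ 6 * m := by
    rw [Finset.sum_coe_sort Ω fun s => κ s ^ 4]
    refine hΩ.sum_le_of_decay hδ_pos (x := x) (fun s _ => pow_le_one₀ (hκ_nonneg s) (hκ_le_one s))
      fun s _ hs => ?_
    have hdist : 0 < dist x s := hδ_pos.trans_le hs
    gcongr
    refine (norm_eval_dirichletPolynomial_le (dist_pos.1 hdist)).trans ?_
    rw [← div_div]
    gcongr
  calc _ ≤ (∑ s : Ω, ‖v s‖ * (B * κ s ^ 4)) ^ 2 := by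
        gcongr
        refine (norm_sum_le _ _).trans (Finset.sum_le_sum fun s _ => ?_)
        rw [norm_mul]
        gcongr
        exact hp s s.2 x
    _ ≤ (∑ s : Ω, κ s ^ 4) * ∑ s : Ω, B ^ 2 * (‖v s‖ ^ 2 * κ s ^ 4) :=
        Finset.sum_sq_le_sum_mul_sum_of_sq_le_mul _ (fun s _ => pow_nonneg (hκ_nonneg s) 4)
          (fun s _ => by positivity) fun s _ => (by ring : _ = _).le
    _ ≤ 6 * m * ∑ s : Ω, B ^ 2 * (‖v s‖ ^ 2 * κ s ^ 2) := by
        refine mul_le_mul hdecay (Finset.sum_le_sum fun s _ => ?_)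
          (Finset.sum_nonneg fun s _ => by positivity) (by positivity)
        gcongr 2
        exact pow_le_pow_of_le_one (hκ_nonneg s) (hκ_le_one s) (by norm_num : 2 ≤ 4)
    _ = _ := by rw [← Finset.mul_sum, mul_assoc (6 * (m : ℝ))]

theorem norm_coefficientMatrix_le (hn : 0 < n) (hδ : 1 / (2 * n) ≤ δ) (hΩ : IsPacked m δ Ω)
    (hdeg : ∀ s ∈ Ω, (p s).natDegree < N)
    (hp : ∀ s ∈ Ω, ∀ x : UnitAddCircle, ‖(p s).eval (AddCircle.toCircle x : ℂ)‖ ≤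
      B * ‖(dirichletPolynomial n s).eval (AddCircle.toCircle x : ℂ)‖ ^ 4) :
    ‖coefficientMatrix N Ω p‖ ≤ √(6 * m * B ^ 2 / n) := by
  classical
  rw [Matrix.l2_opNorm_def]
  refine ContinuousLinearMap.opNorm_le_bound _ (sqrt_nonneg _) fun v => ?_
  refine le_of_sq_le_sq ?_ (by positivity)
  have hcont (q : ℂ[X]) : Continuous fun z => ‖q.eval z‖ ^ 2 := by fun_prop
  have hint (s : Ω) : CircleIntegrable
      (fun z => ‖v s‖ ^ 2 * ‖(dirichletPolynomial n s).eval z‖ ^ 2) 0 1 :=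
    (continuous_const.mul (hcont _)).continuousOn.circleIntegrable'
  calc _ = circleAverage (fun z => ‖∑ s : Ω, v s * (p s).eval z‖ ^ 2) 0 1 :=
        norm_sq_coefficientMatrix_mulVec hdeg v
    _ ≤ circleAverage (fun z => (6 * m * B ^ 2) •
          ∑ s : Ω, ‖v s‖ ^ 2 * ‖(dirichletPolynomial n s).eval z‖ ^ 2) 0 1 := by
        refine circleAverage_mono (Continuous.continuousOn (by fun_prop)).circleIntegrable'
          (Continuous.continuousOn (by fun_prop)).circleIntegrable' fun z hz => ?_
        obtain ⟨x, rfl⟩ := exists_coe_toCircle_eq (z := z) (by simpa using hz)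
        exact norm_sq_sum_mul_eval_le hn hδ hΩ hp v x
    _ = (6 * m * B ^ 2) * ∑ s : Ω, ‖v s‖ ^ 2 * (1 / n) := by
        rw [circleAverage_fun_smul, smul_eq_mul, circleAverage_fun_sum fun s _ => hint s]
        congr 1
        refine Finset.sum_congr rfl fun s _ => ?_
        simp only [← smul_eq_mul (‖v s‖ ^ 2)]
        rw [circleAverage_fun_smul, circleAverage_norm_sq_dirichletPolynomial hn]
    _ = (√(6 * m * B ^ 2 / n) * ‖v‖) ^ 2 := by
        rw [mul_pow, sq_sqrt (by positivity), EuclideanSpace.norm_sq_eq, ← Finset.sum_mul]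
        ring

theorem IsPacked.sum_indicator_pow_four_le (hΩ : IsPacked m δ Ω) (hδ : 0 < δ)
    (x : UnitAddCircle) :
    ∑ s : Ω, (if δ ≤ dist x s then (δ / dist x s) ^ 4 else 0) ≤ 4 * m := by
  rw [Finset.sum_coe_sort Ω fun s => if δ ≤ dist x s then (δ / dist x s) ^ 4 else 0,
    ← Finset.sum_filter]
  exact (hΩ.subset (Finset.filter_subset _ _)).sum_div_dist_pow_four_le hδ fun s hs =>
    (Finset.mem_filter.1 hs).2

end CoefficientMatrix

section LowerBound

open Polynomial Real
open scoped Matrix.Norms.L2Operator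

variable {N m n : ℕ} {Ω : Finset UnitAddCircle} {r δ B : ℝ}
  {cl : UnitAddCircle → Finset UnitAddCircle}

namespace IsClusterMap

theorem mul_dist_le (hcl : IsClusterMap Ω m r δ cl) (hr : n * r ≤ 1 / 2) :
    ∀ t ∈ Ω, ∀ s ∈ cl t, ∀ s' ∈ cl t, n * dist s s' ≤ 1 / 2 := fun t ht s hs s' hs' =>
  (mul_le_mul_of_nonneg_left (hcl.dist_le t ht s hs s' hs') n.cast_nonneg).trans hr

theorem natDegree_localizedPolynomial_lt (hcl : IsClusterMap Ω m r δ cl) (hn : 0 < n)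
    (hr : n * r ≤ 1 / 2) (hN : (m + 3) * n ≤ N) :
    ∀ s ∈ Ω, (localizedPolynomial n (cl s) s).natDegree < N := fun s hs =>
  _root_.natDegree_localizedPolynomial_lt hn hN (hcl.mul_dist_le hr s hs) (hcl.mem_self s hs)
    (hcl.card_le s hs)

theorem norm_eval_localizedPolynomial_le (hcl : IsClusterMap Ω m r δ cl) (hn : 0 < n)
    (hr : n * r ≤ 1 / 2) (hB : ∀ t ∈ Ω, nodalBound n (cl t) t ≤ B) :
    ∀ s ∈ Ω, ∀ x : UnitAddCircle,
      ‖(localizedPolynomial n (cl s) s).eval (AddCircle.toCircle x : ℂ)‖ ≤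
        B * ‖(dirichletPolynomial n s).eval (AddCircle.toCircle x : ℂ)‖ ^ 4 := fun s hs x =>
  (_root_.norm_eval_localizedPolynomial_le hn
    (hcl.mul_dist_le hr s hs s (hcl.mem_self s hs)) x).trans
    (mul_le_mul_of_nonneg_right (hB s hs) (by positivity))

theorem norm_eval_localizedPolynomial_sub_one_le (hcl : IsClusterMap Ω m r δ cl) (hn : 0 < n)
    (hr : n * r ≤ 1 / 2) (hδ : 0 < δ) (hB₀ : 0 ≤ B)
    (hB : ∀ t ∈ Ω, nodalBound n (cl t) t ≤ B) (t s : Ω) :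
    ‖(localizedPolynomial n (cl s) s).eval (AddCircle.toCircle (t : UnitAddCircle) : ℂ) -
        (1 : Matrix Ω Ω ℂ) t s‖ ≤ B * (1 / (2 * n * δ)) ^ 4 *
          if δ ≤ dist (t : UnitAddCircle) s then (δ / dist (t : UnitAddCircle) s) ^ 4 else 0 := by
  have : (0 : ℝ) < n := by exact_mod_cast hn
  have hnonneg : 0 ≤ B * (1 / (2 * n * δ)) ^ 4 *
      if δ ≤ dist (t : UnitAddCircle) s then (δ / dist (t : UnitAddCircle) s) ^ 4 else 0 := by
    positivity
  obtain rfl | hts := eq_or_ne t s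
  · rwa [eval_localizedPolynomial_self hn (hcl.mul_dist_le hr t t.2) (hcl.mem_self t t.2),
      Matrix.one_apply_eq, sub_self, norm_zero]
  rw [Matrix.one_apply_ne hts, sub_zero]
  by_cases hmem : (t : UnitAddCircle) ∈ cl s
  · rwa [eval_localizedPolynomial_of_ne n hmem (Subtype.coe_injective.ne hts), norm_zero]
  have hdist : δ ≤ dist (t : UnitAddCircle) s := dist_comm (s : UnitAddCircle) t ▸
    hcl.le_dist s s.2 t t.2 hmem
  have hdist_pos := hδ.trans_le hdist
  rw [if_pos hdist]
  calc _ ≤ B * (1 / (2 * n * dist (t : UnitAddCircle) s)) ^ 4 := by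
        refine (hcl.norm_eval_localizedPolynomial_le hn hr hB s s.2 t).trans ?_
        gcongr
        exact norm_eval_dirichletPolynomial_le (dist_pos.1 hdist_pos)
    _ = _ := by field_simp

theorem norm_vandermondeMatrix_mul_sub_one_le (hcl : IsClusterMap Ω m r δ cl) (hn : 0 < n)
    (hr : n * r ≤ 1 / 2) (hδ : 0 < δ) (hN : (m + 3) * n ≤ N) (hB₀ : 0 ≤ B)
    (hB : ∀ t ∈ Ω, nodalBound n (cl t) t ≤ B) :
    ‖vandermondeMatrix N Ω * coefficientMatrix N Ω (fun s => localizedPolynomial n (cl s) s) - 1‖ ≤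
      B * (1 / (2 * n * δ)) ^ 4 * (4 * m) := by
  classical
  have hentry (t s : Ω) := by
    simpa only [← vandermondeMatrix_mul_coefficientMatrix (p := fun s => localizedPolynomial n
      (cl s) s) (hcl.natDegree_localizedPolynomial_lt hn hr hN)] using
      hcl.norm_eval_localizedPolynomial_sub_one_le hn hr hδ hB₀ hB t s
  refine l2_opNorm_le_of_sum_norm_le (by positivity) (fun t => ?_) fun s => ?_
  · refine (Finset.sum_le_sum fun s _ => hentry t s).trans ?_
    rw [← Finset.mul_sum]
    gcongr
    exact hcl.isPacked.sum_indicator_pow_four_le hδ t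
  · refine (Finset.sum_le_sum fun t _ => hentry t s).trans ?_
    rw [← Finset.mul_sum]
    gcongr
    simpa only [dist_comm] using hcl.isPacked.sum_indicator_pow_four_le hδ s

theorem le_mul_sigmaMin_sq [Nonempty Ω] (hcl : IsClusterMap Ω m r δ cl) (hm : 0 < m) (hn : 0 < n)
    (hr : n * r ≤ 1 / 2) (hδ : 1 / (2 * n) ≤ δ) (hN : (m + 3) * n ≤ N) (hB₀ : 0 < B)
    (hB : ∀ t ∈ Ω, nodalBound n (cl t) t ≤ B)
    (hsmall : B * (1 / (2 * n * δ)) ^ 4 * (4 * m) ≤ 1 / 2) :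
    (n : ℝ) ≤ 24 * m * B ^ 2 * sigmaMin (vandermondeMatrix N Ω) ^ 2 := by
  classical
  have : (0 : ℝ) < n := by exact_mod_cast hn
  have : (0 : ℝ) < m := by exact_mod_cast hm
  have hδ_pos : 0 < δ := lt_of_lt_of_le (by positivity) hδ
  have hσ := one_le_two_mul_mul_sigmaMin (by positivity)
    (norm_coefficientMatrix_le hn hδ hcl.isPacked
      (hcl.natDegree_localizedPolynomial_lt hn hr hN)
      (hcl.norm_eval_localizedPolynomial_le hn hr hB))
    ((hcl.norm_vandermondeMatrix_mul_sub_one_le hn hr hδ_pos hN hB₀.le hB).trans hsmall)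
  have hsq := pow_le_pow_left₀ zero_le_one hσ 2
  rw [one_pow, mul_pow, mul_pow, sq_sqrt (by positivity)] at hsq
  calc (n : ℝ) = n * 1 := (mul_one _).symm
    _ ≤ _ := mul_le_mul_of_nonneg_left hsq (by positivity)
    _ = _ := by
      field_simp
      ring

end IsClusterMap

end LowerBound

section SeparatedPoints

variable {ι : Type*} {F : Finset ι} {f : ι → ℝ} {τ : ℝ}

theorem card_mul_le_sub_of_separated {a b : ℝ} (hab : a ≤ b)
    (hsep : (F : Set ι).Pairwise fun i j => τ ≤ |f i - f j|) (ha : ∀ i ∈ F, a ≤ f i)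
    (hb : ∀ i ∈ F, f i + τ ≤ b) : F.card * τ ≤ b - a := by
  classical
  induction F using Finset.induction_on_max_value f generalizing b with
  | empty => simpa using hab
  | insert i s hi hmax ih =>
    simp only [Finset.coe_insert, Finset.forall_mem_insert] at hsep ha hb
    have hgap : ∀ j ∈ s, f j + τ ≤ f i := fun j hj => by
      have hij : τ ≤ |f i - f j| := hsep (Set.mem_insert i _) (Set.mem_insert_of_mem i hj)
        (ne_of_mem_of_not_mem hj hi).symm
      rw [abs_of_nonneg (sub_nonneg.2 (hmax j hj))] at hij
      linarith
    have hcard := ih ha.1 (hsep.mono (Set.subset_insert _ _)) ha.2 hgap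
    rw [Finset.card_insert_of_notMem hi, Nat.cast_succ]
    linarith [hb.1]

theorem pow_mul_factorial_le_two_pow_mul_prod_abs_sub (hτ : 0 < τ) {t : ι} (ht : t ∉ F)
    (hsep : (insert t (F : Set ι)).Pairwise fun i j => τ ≤ |f i - f j|) :
    τ ^ F.card * F.card.factorial ≤ 2 ^ F.card * ∏ i ∈ F, |f t - f i| := by
  classical
  induction F using Finset.induction_on_max_value fun i => |f t - f i| with
  | empty => simp
  | insert i s hi hmax ih =>
    rw [Finset.mem_insert, not_or] at ht
    have hs := ih ht.2 (hsep.mono (Set.insert_subset_insert (by simp)))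
    have hcard := card_mul_le_sub_of_separated (F := insert t (insert i s)) (τ := τ)
      (a := f t - |f t - f i|) (b := f t + |f t - f i| + τ) (by linarith [abs_nonneg (f t - f i)])
      (by simpa using hsep) (fun j hj => ?_) fun j hj => ?_
    · rw [Finset.card_insert_of_notMem (by simp [ht]), Finset.card_insert_of_notMem hi] at hcard
      rw [Finset.card_insert_of_notMem hi, Finset.prod_insert hi, Nat.factorial_succ]
      push_cast at hcard ⊢
      have hlast : (s.card + 1) * τ ≤ 2 * |f t - f i| := by linarith
      calc _ = (s.card + 1) * τ * (τ ^ s.card * s.card.factorial) := by ring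
        _ ≤ 2 * |f t - f i| * (2 ^ s.card * ∏ j ∈ s, |f t - f j|) := by
          gcongr
        _ = _ := by ring
    all_goals
      have hj : |f t - f j| ≤ |f t - f i| := by
        simp only [Finset.mem_insert] at hj
        rcases hj with rfl | rfl | hj
        · simp
        · exact le_rfl
        · exact hmax j hj
      linarith [abs_le.1 hj]

end SeparatedPoints

section NodalBound

theorem nodalBound_le_of_separated {n : ℕ} {K : Finset UnitAddCircle} {t : UnitAddCircle}
    (ht : t ∈ K) {f : UnitAddCircle → ℝ} {τ : ℝ} (hn : 0 < n) (hτ : 0 < τ)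
    (hf : ∀ s ∈ K, dist t s = |f t - f s|)
    (hsep : (K : Set UnitAddCircle).Pairwise fun s s' => τ ≤ |f s - f s'|) :
    nodalBound n K t ≤ (1 / (n * τ)) ^ (K.card - 1) / (K.card - 1).factorial := by
  classical
  have : (0 : ℝ) < n := by exact_mod_cast hn
  have hprod := pow_mul_factorial_le_two_pow_mul_prod_abs_sub hτ (Finset.notMem_erase t K)
    (by rwa [← Finset.coe_insert, Finset.insert_erase ht])
  have hdist : ∏ s ∈ K.erase t, |f t - f s| = ∏ s ∈ K.erase t, dist t s :=
    Finset.prod_congr rfl fun s hs => (hf s (Finset.mem_of_mem_erase hs)).symm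
  rw [hdist, ← div_le_iff₀' (by positivity), Finset.card_erase_of_mem ht] at hprod
  calc nodalBound n K t = 1 / ((2 * n) ^ (K.card - 1) * ∏ s ∈ K.erase t, dist t s) := by
        rw [nodalBound, Finset.prod_div_distrib, Finset.prod_const_one, Finset.prod_mul_distrib,
          Finset.prod_const, Finset.card_erase_of_mem ht]
    _ ≤ 1 / ((2 * n) ^ (K.card - 1) *
          (τ ^ (K.card - 1) * (K.card - 1).factorial / 2 ^ (K.card - 1))) := by gcongr
    _ = _ := by
      rw [mul_pow, div_pow, one_pow, mul_pow]
      field_simp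

end NodalBound

section Configurations

variable {N m : ℕ} {τ : ℝ} {Ω : Finset UnitAddCircle}

/-- The lower bound for the cluster separation `ρ` in the definition of `𝒦(N, m, τ)`, as a function
of the cluster complexity. -/
noncomputable def separationThreshold (m : ℕ) (C : ℝ) : ℝ :=
  2 * m * √(2 * √2 * (m : ℝ) ^ m * (Real.pi ^ 2 / 6) * C)

theorem continuous_separationThreshold (m : ℕ) : Continuous (separationThreshold m) := by
  unfold separationThreshold
  fun_prop

theorem sqrt_le_separationThreshold (hm : 0 < m) (C : ℝ) : √C ≤ separationThreshold m C := by
  have hone : (1 : ℝ) ≤ m := by exact_mod_cast hm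
  have hfactor : 1 ≤ 2 * √2 * (m : ℝ) ^ m * (Real.pi ^ 2 / 6) := by
    have hsqrt : 1 ≤ 2 * √2 := by linarith [Real.one_le_sqrt.2 one_le_two]
    have hpi : 1 ≤ Real.pi ^ 2 / 6 := by nlinarith [Real.pi_gt_three]
    exact one_le_mul_of_one_le_of_one_le
      (one_le_mul_of_one_le_of_one_le hsqrt (one_le_pow₀ hone)) hpi
  rw [separationThreshold, Real.sqrt_mul (by positivity), ← mul_assoc]
  refine le_mul_of_one_le_left (Real.sqrt_nonneg _) ?_
  exact one_le_mul_of_one_le_of_one_le (by linarith) (Real.one_le_sqrt.2 hfactor)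

theorem ofReal_le_clusterSeparation_iff {L : ℕ} {Λ : Fin L → Finset UnitAddCircle} {r : ℝ} :
    ENNReal.ofReal r ≤ clusterSeparation N Λ ↔
      ∀ l l', l ≠ l' → ∀ t ∈ Λ l, ∀ t' ∈ Λ l', r ≤ N * dist t t' := by
  simp only [clusterSeparation, le_iInf_iff]
  refine forall₅_congr fun l l' _ t _ => forall₂_congr fun t' _ => ?_
  exact ENNReal.ofReal_le_ofReal_iff (by positivity)

theorem clusterComplexity_eq_iSup_prod_max (hN : 0 < N) (Ω : Finset UnitAddCircle) :
    clusterComplexity N Ω =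
      ⨆ t : Ω, ∏ t' ∈ Ω, max (1 / (N * dist (t : UnitAddCircle) t')) 1 := by
  classical
  have hN' : (0 : ℝ) < N := by exact_mod_cast hN
  refine iSup_congr fun t => ?_
  rw [Finset.prod_filter]
  refine Finset.prod_congr rfl fun t' _ => ?_
  obtain hzero | hpos := (dist_nonneg (x := (t : UnitAddCircle)) (y := t')).eq_or_lt
  · simp [← hzero]
  have hscaled : 0 < N * dist (t : UnitAddCircle) t' := mul_pos hN' hpos
  have hclose : dist (t : UnitAddCircle) t' ≤ 1 / N ↔
      1 ≤ 1 / (N * dist (t : UnitAddCircle) t') := by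
    rw [le_div_iff₀' hN', one_le_div hscaled]
  split_ifs with h
  · rw [max_eq_left (hclose.1 h.2)]
  · rw [max_eq_right (not_le.1 fun h' => h ⟨hpos, hclose.2 h'⟩).le]

theorem prod_max_le_clusterComplexity (hN : 0 < N) {t : UnitAddCircle} (ht : t ∈ Ω) :
    ∏ t' ∈ Ω, max (1 / (N * dist t t')) 1 ≤ clusterComplexity N Ω := by
  rw [clusterComplexity_eq_iSup_prod_max hN]
  exact le_ciSup (f := fun t : Ω => ∏ t' ∈ Ω, max (1 / (N * dist (t : UnitAddCircle) t')) 1)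
    (Set.finite_range _).bddAbove ⟨t, ht⟩

theorem minimalSeparation_eq_iff (hN : 0 < N) (hτ : 0 < τ) :
    minimalSeparation N Ω = τ ↔
      (∀ t ∈ Ω, ∀ t' ∈ Ω, t ≠ t' → τ ≤ N * dist t t') ∧
        ∃ t ∈ Ω, ∃ t' ∈ Ω, t ≠ t' ∧ N * dist t t' = τ := by
  classical
  have hN' : (0 : ℝ) < N := by exact_mod_cast hN
  rw [minimalSeparation, Finset.coe_infsep]
  constructor
  · intro h
    split_ifs at h with hs
    · refine ⟨fun t ht t' ht' hne => ?_, ?_⟩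
      · rw [← h]
        exact mul_le_mul_of_nonneg_left
          (Finset.inf'_le (Function.uncurry dist) (b := (t, t'))
            (Finset.mem_offDiag.2 ⟨ht, ht', hne⟩)) hN'.le
      · obtain ⟨⟨t, t'⟩, hp, he⟩ := Finset.exists_mem_eq_inf' hs (Function.uncurry dist)
        obtain ⟨ht, ht', hne⟩ := Finset.mem_offDiag.1 hp
        exact ⟨t, ht, t', ht', hne, by rw [← h, he, Function.uncurry_apply_pair]⟩
    · rw [mul_zero] at h
      exact absurd h hτ.ne
  · rintro ⟨hmin, t, ht, t', ht', hne, h⟩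
    have hmem : (t, t') ∈ Ω.offDiag := Finset.mem_offDiag.2 ⟨ht, ht', hne⟩
    rw [dif_pos ⟨_, hmem⟩]
    refine le_antisymm (h ▸ mul_le_mul_of_nonneg_left (Finset.inf'_le _ hmem) hN'.le) ?_
    rw [← div_le_iff₀' hN']
    refine Finset.le_inf' _ _ fun p hp => ?_
    obtain ⟨hp₁, hp₂, hp₃⟩ := Finset.mem_offDiag.1 hp
    exact (div_le_iff₀' hN').2 (hmin _ hp₁ _ hp₂ hp₃)

theorem one_div_le_clusterComplexity (hN : 0 < N) (hτ : 0 < τ)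
    (hΩ : minimalSeparation N Ω = τ) : 1 / τ ≤ clusterComplexity N Ω := by
  obtain ⟨-, t, ht, t', ht', -, rfl⟩ := (minimalSeparation_eq_iff hN hτ).1 hΩ
  exact (Finset.le_prod_max_one ht' fun s => 1 / (N * dist t s)).trans
    (prod_max_le_clusterComplexity hN ht)

theorem nodalBound_le_mul_clusterComplexity {n : ℕ} {R : ℝ} (hn : 0 < n) (hN : 0 < N) (hR : 1 ≤ R)
    (hNR : N ≤ 2 * n * R) {K : Finset UnitAddCircle} (hKΩ : K ⊆ Ω) (hK : K.card ≤ m)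
    {t : UnitAddCircle} (ht : t ∈ Ω) : nodalBound n K t ≤ R ^ m * clusterComplexity N Ω := by
  classical
  have : (0 : ℝ) < n := by exact_mod_cast hn
  have : (0 : ℝ) < N := by exact_mod_cast hN
  have hsub : K.erase t ⊆ Ω := (Finset.erase_subset t K).trans hKΩ
  have hfactor (s : UnitAddCircle) :
      1 / (2 * n * dist t s) ≤ R * max (1 / (N * dist t s)) 1 :=
    calc 1 / (2 * n * dist t s) = N / (2 * n) * (1 / (N * dist t s)) := by field_simp
      _ ≤ R * max (1 / (N * dist t s)) 1 := by
        gcongr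
        · rwa [div_le_iff₀' (by positivity)]
        · exact le_max_left _ _
  calc nodalBound n K t ≤ ∏ s ∈ K.erase t, R * max (1 / (N * dist t s)) 1 :=
        Finset.prod_le_prod (fun s _ => by positivity) fun s _ => hfactor s
    _ = R ^ (K.erase t).card * ∏ s ∈ K.erase t, max (1 / (N * dist t s)) 1 := by
        rw [Finset.prod_mul_distrib, Finset.prod_const]
    _ ≤ R ^ m * ∏ s ∈ Ω, max (1 / (N * dist t s)) 1 := by
        gcongr
        · exact (Finset.card_le_card (Finset.erase_subset t K)).trans hK
        · exact fun s _ _ => le_max_right _ _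
    _ ≤ R ^ m * clusterComplexity N Ω := by
        gcongr
        exact prod_max_le_clusterComplexity hN ht

theorem IsCluster.exists_isometric_lift (hN : 2 ≤ N) {K : Finset UnitAddCircle}
    (hK : IsCluster N K) : ∃ f : UnitAddCircle → ℝ, ∀ s ∈ K, ∀ s' ∈ K,
      dist s s' = |f s - f s'| ∧ dist s s' ≤ 1 / N := by
  obtain ⟨a, ha⟩ := hK
  choose! f hlow hup hf using ha
  refine ⟨f, fun s hs s' hs' => ?_⟩
  have hle : |f s - f s'| ≤ 1 / N := by
    rw [abs_le]
    constructor <;> linarith [hlow s hs, hup s hs, hlow s' hs', hup s' hs']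
  have hhalf : (1 : ℝ) / N ≤ 1 / 2 := by
    gcongr
    exact_mod_cast hN
  have hdist : dist s s' = |f s - f s'| := by
    rw [dist_eq_norm, ← norm_coe_unitAddCircle_of_abs_le (hle.trans hhalf), AddCircle.coe_sub,
      hf s hs, hf s' hs']
  exact ⟨hdist, hdist ▸ hle⟩

theorem exists_isClusterMap (hN : 2 ≤ N) (hΩ : Ω ∈ admissibleConfigurations N m τ) :
    ∃ cl : UnitAddCircle → Finset UnitAddCircle,
      IsClusterMap Ω m (1 / N) (separationThreshold m (clusterComplexity N Ω) / N) cl ∧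
        ∀ t ∈ Ω, IsCluster N (cl t) := by
  have hN' : (0 : ℝ) < N := by positivity
  obtain ⟨-, -, L, Λ, hΛ, hgreatest, hsep⟩ := hΩ
  have hmem (t) : t ∈ Ω ↔ ∃ l, t ∈ Λ l := by
    rw [← Finset.mem_coe, ← hΛ.iUnion_eq]
    simp
  have : Nonempty (Fin L) := ⟨hgreatest.1.choose⟩
  choose! l hl using fun t => (hmem t).1
  refine ⟨fun t => Λ (l t), ⟨hl, fun t _ s hs => (hmem s).2 ⟨_, hs⟩,
    fun t _ => hgreatest.2 ⟨_, rfl⟩, fun t _ s hs s' hs' => ?_, fun t ht s hs hns => ?_⟩,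
    fun t _ => hΛ.isCluster _⟩
  · obtain ⟨f, hf⟩ := (hΛ.isCluster (l t)).exists_isometric_lift hN
    exact (hf s hs s' hs').2
  · rw [div_le_iff₀' hN']
    exact ofReal_le_clusterSeparation_iff.1 hsep (l t) (l s)
      (fun h => hns (h ▸ hl s hs)) t (hl t ht) s (hl s hs)

end Configurations

section LowerBoundConstants

theorem exists_mul_le_and_le_two_mul_mul {d N : ℕ} (hd : 0 < d) (hN : d ≤ N) :
    ∃ n, 0 < n ∧ d * n ≤ N ∧ N ≤ 2 * n * d := by
  refine ⟨N / d, Nat.div_pos hN hd, Nat.mul_div_le N d, ?_⟩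
  have hlt := Nat.lt_mul_div_succ N hd
  have hpos := Nat.mul_le_mul_left d (Nat.div_pos hN hd)
  nlinarith

theorem exp_add_three_le_pow {m : ℕ} (hm : 2 ≤ m) : Real.exp (m + 3) ≤ 243 ^ (m - 1) := by
  obtain ⟨k, rfl⟩ := Nat.exists_eq_add_of_le' hm
  have hexp : Real.exp ((k + 2 : ℕ) + 3) = Real.exp 1 ^ (k + 5) := by
    rw [← Real.exp_nat_mul]
    push_cast
    ring_nf
  rw [hexp]
  calc Real.exp 1 ^ (k + 5) ≤ 3 ^ (k + 5) := by
        gcongr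
        exact Real.exp_one_lt_three.le
    _ ≤ (3 : ℝ) ^ (5 * (k + 1)) := pow_le_pow_right₀ (by norm_num) (by omega)
    _ = 243 ^ (k + 2 - 1) := by
        rw [pow_mul]
        norm_num

theorem forty_eight_mul_mul_le_pow {m : ℕ} (hm : 2 ≤ m) :
    48 * m * (m + 3) ≤ (25 ^ (m - 1)) ^ 2 := by
  induction m, hm using Nat.le_induction with
  | base => norm_num
  | succ k hk ih =>
    obtain ⟨j, rfl⟩ := Nat.exists_eq_add_of_le' hk
    simp only [Nat.add_sub_cancel, show j + 2 - 1 = j + 1 by omega] at ih ⊢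
    rw [pow_succ 25 (j + 1), mul_pow]
    nlinarith

variable {N m n : ℕ} {τ : ℝ}

theorem nodalBound_le_pow (hm : 2 ≤ m) (hN : 2 ≤ N) (hn : 0 < n) (hNn : N ≤ 2 * n * (m + 3 : ℝ))
    (hτ : 0 < τ) (hτ_le : τ ≤ 1) {K : Finset UnitAddCircle} (hK : IsCluster N K)
    (hcard : K.card ≤ m) (hsep : ∀ s ∈ K, ∀ s' ∈ K, s ≠ s' → τ ≤ N * dist s s')
    {t : UnitAddCircle} (ht : t ∈ K) : nodalBound n K t ≤ (486 / τ) ^ (m - 1) := by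
  have hN' : (0 : ℝ) < N := by positivity
  have : (0 : ℝ) < n := by exact_mod_cast hn
  obtain ⟨f, hf⟩ := hK.exists_isometric_lift hN
  have hbound := nodalBound_le_of_separated ht (τ := τ / N) (f := f) hn (by positivity)
    (fun s hs => (hf t ht s hs).1) fun s hs s' hs' hne => by
      change τ / N ≤ |f s - f s'|
      rw [div_le_iff₀' hN', ← (hf s hs s' hs').1]
      exact hsep s hs s' hs' hne
  have hratio : 1 / (n * (τ / N)) ≤ 2 / τ * (m + 3) := by
    rw [div_mul_eq_mul_div, mul_div_assoc', one_div_div]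
    rw [div_le_div_iff₀ (by positivity) hτ]
    nlinarith
  calc nodalBound n K t ≤ (1 / (n * (τ / N))) ^ (K.card - 1) / (K.card - 1).factorial := hbound
    _ ≤ (2 / τ * (m + 3)) ^ (K.card - 1) / (K.card - 1).factorial := by gcongr
    _ = (2 / τ) ^ (K.card - 1) * ((m + 3) ^ (K.card - 1) / (K.card - 1).factorial) := by
        rw [mul_pow, mul_div_assoc]
    _ ≤ (2 / τ) ^ (m - 1) * Real.exp (m + 3) := by
        gcongr
        · rw [one_le_div hτ]
          linarith
        · exact Real.pow_div_factorial_le_exp (x := m + 3) (by positivity) _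
    _ ≤ (2 / τ) ^ (m - 1) * 243 ^ (m - 1) := by
        gcongr
        exact exp_add_three_le_pow hm
    _ = (486 / τ) ^ (m - 1) := by
        rw [← mul_pow]
        congr 1
        ring

theorem pow_four_mul_le_of_sq_le {C R T : ℝ} (hC : 0 < C) (hR : C ≤ R ^ 2)
    (hCT : 8 * m * T ^ (m + 4) ≤ C) : T ^ m * C * (T / R) ^ 4 * (4 * m) ≤ 1 / 2 := by
  have hR₀ : R ≠ 0 := by
    rintro rfl
    linarith
  have hR₄ : C ^ 2 ≤ R ^ 4 := by nlinarith
  calc T ^ m * C * (T / R) ^ 4 * (4 * m) = C * (8 * m * T ^ (m + 4)) / (2 * R ^ 4) := by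
        field_simp
        ring
    _ ≤ C * C / (2 * R ^ 4) := by gcongr
    _ ≤ R ^ 4 / (2 * R ^ 4) := by
        gcongr
        linarith
    _ = 1 / 2 := by field_simp

theorem mul_le_one_eighth (hm : 0 < m) (hτ_le : τ ≤ 1 / (8 * m * (m + 3) ^ (m + 4))) :
    m * τ ≤ 1 / 8 := by
  have hone : (1 : ℝ) ≤ (m + 3) ^ (m + 4) := one_le_pow₀ (by linarith [m.cast_nonneg (α := ℝ)])
  calc m * τ ≤ m * (1 / (8 * m * (m + 3) ^ (m + 4))) := by gcongr
    _ = 1 / 8 * (1 / (m + 3) ^ (m + 4)) := by field_simp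
    _ ≤ 1 / 8 := mul_le_of_le_one_right (by norm_num) ((div_le_one (by positivity)).2 hone)

theorem add_three_le_separationThreshold (hm : 0 < m) {C : ℝ} (hC : 8 * m * (m + 3) ^ (m + 4) ≤ C) :
    m + 3 ≤ separationThreshold m C := by
  have hone : (1 : ℝ) ≤ m := by exact_mod_cast hm
  refine (Real.le_sqrt_of_sq_le ?_).trans (sqrt_le_separationThreshold hm C)
  calc ((m : ℝ) + 3) ^ 2 ≤ (m + 3) ^ (m + 4) := pow_le_pow_right₀ (by linarith) (by omega)
    _ ≤ 8 * m * (m + 3) ^ (m + 4) := le_mul_of_one_le_left (by positivity) (by linarith)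
    _ ≤ C := hC

end LowerBoundConstants

section LowerBoundTheorem

variable {N m n : ℕ} {τ : ℝ} {Ω : Finset UnitAddCircle}

theorem nonempty_of_mem_admissibleConfigurations
    (hΩ : Ω ∈ admissibleConfigurations N m τ) : Ω.Nonempty := by
  obtain ⟨-, -, L, Λ, hΛ, ⟨⟨l, -⟩, -⟩, -⟩ := hΩ
  obtain ⟨t, ht⟩ := hΛ.nonempty l
  exact ⟨t, Finset.mem_coe.1 (hΛ.iUnion_eq ▸ Set.mem_iUnion.2 ⟨l, ht⟩)⟩

theorem IsClusterMap.nodalBound_le_min {r δ : ℝ} {cl : UnitAddCircle → Finset UnitAddCircle}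
    (hcl : IsClusterMap Ω m r δ cl) (hm : 2 ≤ m) (hN : 2 ≤ N) (hn : 0 < n)
    (hNn : N ≤ 2 * n * (m + 3 : ℝ)) (hτ : 0 < τ) (hτ_le : τ ≤ 1)
    (hΩ : minimalSeparation N Ω = τ) {t : UnitAddCircle} (ht : t ∈ Ω)
    (hcluster : IsCluster N (cl t)) :
    nodalBound n (cl t) t ≤
      min ((486 / τ) ^ (m - 1)) ((m + 3) ^ m * clusterComplexity N Ω) := by
  have hsub := hcl.subset t ht
  have hsep := ((minimalSeparation_eq_iff (by omega) hτ).1 hΩ).1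
  exact le_min
    (nodalBound_le_pow hm hN hn hNn hτ hτ_le hcluster (hcl.card_le t ht)
      (fun s hs s' hs' => hsep s (hsub hs) s' (hsub hs')) (hcl.mem_self t ht))
    (nodalBound_le_mul_clusterComplexity hn (by omega) (by linarith) hNn hsub (hcl.card_le t ht) ht)

theorem le_mul_sigmaMin_sq_of_mem_admissibleConfigurations (hm : 2 ≤ m) (hn : 0 < n)
    (hnN : (m + 3) * n ≤ N) (hNn : N ≤ 2 * n * (m + 3)) (hτ : 0 < τ)
    (hτ_le : τ ≤ 1 / (8 * m * (m + 3) ^ (m + 4))) (hΩ : Ω ∈ admissibleConfigurations N m τ) :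
    (n : ℝ) ≤ 24 * m * ((486 / τ) ^ (m - 1)) ^ 2 * sigmaMin (vandermondeMatrix N Ω) ^ 2 := by
  have hm' : (2 : ℝ) ≤ m := by exact_mod_cast hm
  have hN : 2 ≤ N := by nlinarith
  have hNn' : (N : ℝ) ≤ 2 * n * (m + 3) := by exact_mod_cast hNn
  have : (0 : ℝ) < n := by exact_mod_cast hn
  have : (0 : ℝ) < N := by positivity
  obtain ⟨cl, hcl, hcluster⟩ := exists_isClusterMap hN hΩ
  have : Nonempty Ω := (nonempty_of_mem_admissibleConfigurations hΩ).to_subtype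
  set C := clusterComplexity N Ω
  set R := separationThreshold m C
  have hCτ : 8 * m * (m + 3) ^ (m + 4) ≤ C := (le_one_div (by positivity) hτ).2 hτ_le |>.trans
    (one_div_le_clusterComplexity (by omega) hτ hΩ.2.1)
  have hC : 0 < C := lt_of_lt_of_le (by positivity) hCτ
  have hCR : √C ≤ R := sqrt_le_separationThreshold (by omega) C
  have hTR : m + 3 ≤ R := add_three_le_separationThreshold (by omega) hCτ
  have hR : 0 < R := by linarith
  have hratio : 1 / (2 * n * (R / N)) ≤ (m + 3) / R := by
    rw [mul_div_assoc', one_div_div]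
    rw [div_le_div_iff₀ (by positivity) hR]
    nlinarith
  have hτ_one : τ ≤ 1 := by nlinarith [mul_le_one_eighth (by omega) hτ_le]
  refine (hcl.le_mul_sigmaMin_sq (by omega) hn ?_ ?_ hnN (by positivity)
    (fun t ht => hcl.nodalBound_le_min hm hN hn hNn' hτ hτ_one hΩ.2.1 ht (hcluster t ht))
    ?_).trans ?_
  · have hnN' : ((m : ℝ) + 3) * n ≤ N := by exact_mod_cast hnN
    rw [mul_one_div, div_le_div_iff₀ (by positivity) two_pos]
    nlinarith
  · rw [div_le_div_iff₀ (by positivity) (by positivity)]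
    nlinarith
  · refine le_trans ?_ (pow_four_mul_le_of_sq_le (m := m) (T := m + 3) hC
      ((Real.sqrt_le_left hR.le).1 hCR) hCτ)
    have hpow := pow_le_pow_left₀ (by positivity) hratio 4
    gcongr
    exact min_le_right _ _
  · gcongr
    exact min_le_left _ _

theorem sqrt_mul_pow_le_sigmaMin (hm : 2 ≤ m) (hN : m + 3 ≤ N) (hτ : 0 < τ)
    (hτ_le : τ ≤ 1 / (8 * m * (m + 3) ^ (m + 4))) (hΩ : Ω ∈ admissibleConfigurations N m τ) :
    √N * (1 / 12150 * τ) ^ (m - 1) ≤ sigmaMin (vandermondeMatrix N Ω) := by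
  obtain ⟨n, hn, hnN, hNn⟩ := exists_mul_le_and_le_two_mul_mul (by omega) hN
  have hσ := le_mul_sigmaMin_sq_of_mem_admissibleConfigurations hm hn hnN hNn hτ hτ_le hΩ
  have hpow : (48 * m * (m + 3) : ℝ) ≤ (25 ^ (m - 1)) ^ 2 := by
    exact_mod_cast forty_eight_mul_mul_le_pow hm
  suffices hsqrt : √N ≤ (12150 / τ) ^ (m - 1) * sigmaMin (vandermondeMatrix N Ω) by
    calc √N * (1 / 12150 * τ) ^ (m - 1)
        ≤ (12150 / τ) ^ (m - 1) * sigmaMin (vandermondeMatrix N Ω) * (1 / 12150 * τ) ^ (m - 1) := by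
          gcongr
      _ = sigmaMin (vandermondeMatrix N Ω) := by
          rw [mul_right_comm, ← mul_pow]
          field_simp
          simp
  refine Real.sqrt_le_iff.2 ⟨mul_nonneg (by positivity) (sigmaMin_nonneg _), ?_⟩
  calc (N : ℝ) ≤ 2 * n * (m + 3) := by exact_mod_cast hNn
    _ ≤ 2 * (24 * m * ((486 / τ) ^ (m - 1)) ^ 2 * sigmaMin (vandermondeMatrix N Ω) ^ 2) *
          (m + 3) := by gcongr
    _ = 48 * m * (m + 3) * ((486 / τ) ^ (m - 1) * sigmaMin (vandermondeMatrix N Ω)) ^ 2 := by ring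
    _ ≤ (25 ^ (m - 1)) ^ 2 * ((486 / τ) ^ (m - 1) * sigmaMin (vandermondeMatrix N Ω)) ^ 2 := by
        gcongr
    _ = ((12150 / τ) ^ (m - 1) * sigmaMin (vandermondeMatrix N Ω)) ^ 2 := by
        rw [← mul_pow, ← mul_assoc, ← mul_pow, mul_div_assoc']
        norm_num

end LowerBoundTheorem

section NodeFamilies

variable {ι : Type*} [Fintype ι]

theorem sigmaMin_submatrix_equiv {κ n : Type*} [Fintype κ] [Fintype n] (A : Matrix ι n ℂ)
    (e : κ ≃ ι) : sigmaMin (A.submatrix e id) = sigmaMin A := by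
  unfold sigmaMin
  congr 1
  ext r
  refine (LinearIsometryEquiv.piLpCongrLeft 2 ℂ ℂ e).toEquiv.exists_congr fun v => ?_
  have hmul : (A.submatrix e id).conjTranspose.mulVec v.ofLp =
      A.conjTranspose.mulVec (LinearIsometryEquiv.piLpCongrLeft 2 ℂ ℂ e v).ofLp := by
    ext k
    simpa [Matrix.mulVec, dotProduct] using e.sum_comp fun i => star (A i k) * v (e.symm i)
  rw [hmul]
  exact and_congr_left fun _ => by simp

/-- The matrix with entries `z_i ^ k`, `z_i = exp (2 π i x_i)`, of a family of nodes `x`. Unlike the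
rows of `vandermondeMatrix`, its rows do not depend on the nodes, so that the nodes may move. -/
noncomputable def familyVandermonde (N : ℕ) (x : ι → UnitAddCircle) : Matrix ι (Fin N) ℂ :=
  Matrix.of fun i k => (AddCircle.toCircle (x i) : ℂ) ^ (k : ℕ)

theorem sigmaMin_vandermondeMatrix_image [DecidableEq UnitAddCircle] (N : ℕ)
    {x : ι → UnitAddCircle} (hx : x.Injective) :
    sigmaMin (vandermondeMatrix N (Finset.univ.image x)) = sigmaMin (familyVandermonde N x) := by
  have hbij : Function.Bijective fun i => (⟨x i, Finset.mem_image_of_mem x (Finset.mem_univ i)⟩ :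
      Finset.univ.image x) :=
    ⟨fun i j h => hx (congrArg Subtype.val h), fun ⟨t, ht⟩ => by
      simpa [Subtype.ext_iff] using ht⟩
  exact (sigmaMin_submatrix_equiv _ (Equiv.ofBijective _ hbij)).symm

theorem continuous_sigmaMin_familyVandermonde (N : ℕ) :
    Continuous fun x : ι → UnitAddCircle => sigmaMin (familyVandermonde N x) := by
  have hmatrix : Continuous fun x : ι → UnitAddCircle => familyVandermonde N x := by
    have := AddCircle.continuous_toCircle (T := 1)
    refine continuous_pi fun i => continuous_pi fun k => ?_
    simp only [familyVandermonde, Matrix.of_apply]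
    fun_prop
  convert (isCompact_sphere (0 : EuclideanSpace ℂ ι) 1).continuous_sInf
    (f := fun (x : ι → UnitAddCircle) (v : EuclideanSpace ℂ ι) =>
      ‖(WithLp.toLp 2 ((familyVandermonde N x).conjTranspose.mulVec v.ofLp) :
        EuclideanSpace ℂ (Fin N))‖) (by
      change Continuous fun p : (ι → UnitAddCircle) × EuclideanSpace ℂ ι =>
        ‖(WithLp.toLp 2 ((familyVandermonde N p.1).conjTranspose.mulVec p.2.ofLp) :
          EuclideanSpace ℂ (Fin N))‖
      fun_prop) using 2 with x
  unfold sigmaMin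
  congr 1
  ext r
  simp [eq_comm]

end NodeFamilies

section ClosedConditions

variable {ι : Type*} {N : ℕ} {τ : ℝ}

/-- The families whose nodes pairwise have normalized distance at least `τ`. -/
def separatedFamilies (ι : Type*) (N : ℕ) (τ : ℝ) : Set (ι → UnitAddCircle) :=
  {x | ∀ i j, i ≠ j → τ ≤ N * dist (x i) (x j)}

theorem isClosed_separatedFamilies : IsClosed (separatedFamilies ι N τ) := by
  simp only [separatedFamilies, Set.ofPred_forall]
  exact isClosed_iInter fun i => isClosed_iInter fun j => isClosed_iInter fun _ =>
    isClosed_le continuous_const (by fun_prop)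

theorem injective_of_mem_separatedFamilies (hτ : 0 < τ) {x : ι → UnitAddCircle}
    (hx : x ∈ separatedFamilies ι N τ) : x.Injective := fun i j hij => by
  by_contra hne
  have hle := hx i j hne
  rw [hij, dist_self, mul_zero] at hle
  linarith

theorem isClosed_setOf_exists_mul_dist_eq [Finite ι] :
    IsClosed {x : ι → UnitAddCircle | ∃ i j, i ≠ j ∧ N * dist (x i) (x j) = τ} := by
  simp only [Set.ofPred_exists, Set.ofPred_and]
  exact isClosed_iUnion_of_finite fun i => isClosed_iUnion_of_finite fun j =>
    isClosed_const.inter (isClosed_eq (by fun_prop) continuous_const)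

theorem isCluster_iff {K : Finset UnitAddCircle} :
    IsCluster N K ↔ ∃ a : UnitAddCircle, ∀ t ∈ K,
      t - a ∈ (fun r : ℝ => (r : UnitAddCircle)) '' Set.Icc 0 (1 / N) := by
  rw [(QuotientAddGroup.mk_surjective (s := AddSubgroup.zmultiples (1 : ℝ))).exists]
  refine exists_congr fun a => forall₂_congr fun t _ => ?_
  constructor
  · rintro ⟨r, hlow, hup, rfl⟩
    exact ⟨r - a, ⟨by linarith, by linarith⟩, AddCircle.coe_sub _ _ _⟩
  · rintro ⟨r, hr, h⟩
    exact ⟨a + r, by linarith [hr.1], by linarith [hr.2], eq_sub_iff_add_eq'.1 h⟩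

variable [DecidableEq UnitAddCircle]

theorem isClosed_setOf_isCluster_image (s : Finset ι) :
    IsClosed {x : ι → UnitAddCircle | IsCluster N (s.image x)} := by
  have harc : IsClosed ((fun r : ℝ => (r : UnitAddCircle)) '' Set.Icc 0 (1 / (N : ℝ))) :=
    (isCompact_Icc.image (AddCircle.continuous_mk' 1)).isClosed
  have himage : {x : ι → UnitAddCircle | IsCluster N (s.image x)} =
      Prod.fst '' {p : (ι → UnitAddCircle) × UnitAddCircle | ∀ i ∈ s,
        p.1 i - p.2 ∈ (fun r : ℝ => (r : UnitAddCircle)) '' Set.Icc 0 (1 / (N : ℝ))} := by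
    ext x
    simp only [Set.mem_ofPred_eq, isCluster_iff, Finset.forall_mem_image,
      Set.mem_image (f := Prod.fst), Prod.exists, exists_and_right, exists_eq_right]
  rw [himage]
  refine isClosedMap_fst_of_compactSpace _ ?_
  simp only [Set.ofPred_forall]
  exact isClosed_iInter fun i => isClosed_iInter fun _ => harc.preimage (by fun_prop)

variable [Fintype ι]

theorem clusterComplexity_image_univ (hN : 0 < N) {x : ι → UnitAddCircle} (hx : x.Injective) :
    clusterComplexity N (Finset.univ.image x) =
      ⨆ i, ∏ j, max (1 / (N * dist (x i) (x j))) 1 := by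
  have hsurj : Function.Surjective fun i => (⟨x i, Finset.mem_image_of_mem x (Finset.mem_univ i)⟩ :
      Finset.univ.image x) := fun ⟨t, ht⟩ => by simpa [Subtype.ext_iff] using ht
  rw [clusterComplexity_eq_iSup_prod_max hN, ← hsurj.iSup_comp]
  exact iSup_congr fun i => Finset.prod_image hx.injOn

theorem continuousOn_clusterComplexity_image_univ (hN : 0 < N) (hτ : 0 < τ) :
    ContinuousOn (fun x : ι → UnitAddCircle => clusterComplexity N (Finset.univ.image x))
      (separatedFamilies ι N τ) := by
  suffices hprod : ContinuousOn
      (fun x : ι → UnitAddCircle => ⨆ i, ∏ j, max (1 / (N * dist (x i) (x j))) 1)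
      (separatedFamilies ι N τ) by
    refine hprod.congr fun x hx => ?_
    exact clusterComplexity_image_univ hN (injective_of_mem_separatedFamilies hτ hx)
  cases isEmpty_or_nonempty ι
  · simp only [Real.iSup_of_isEmpty]
    exact continuousOn_const
  simp only [← Finset.sup'_univ_eq_ciSup]
  refine ContinuousOn.finset_sup'_apply _ fun i _ => continuousOn_finsetProd _ fun j _ => ?_
  obtain rfl | hij := eq_or_ne i j
  · simp only [dist_self]
    exact continuousOn_const
  · refine ContinuousOn.sup (continuousOn_const.div (by fun_prop) fun x hx => ?_) continuousOn_const
    exact (hτ.trans_le (hx i j hij)).ne'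

/-- The families with node set in `𝒦(N, m, τ)` and clusters indexed by the sets `φ l`, where the
conditions on the sizes of the clusters, which only concern `φ`, are left out. -/
def clusteredFamilies (N m : ℕ) (τ : ℝ) {L : ℕ} (φ : Fin L → Finset ι) :
    Set (ι → UnitAddCircle) :=
  {x | x ∈ separatedFamilies ι N τ ∧ (∃ i j, i ≠ j ∧ N * dist (x i) (x j) = τ) ∧
    (∀ l, IsCluster N ((φ l).image x)) ∧
    ∀ l l', l ≠ l' → ∀ i ∈ φ l, ∀ j ∈ φ l',
      separationThreshold m (clusterComplexity N (Finset.univ.image x)) ≤ N * dist (x i) (x j)}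

theorem isClosed_clusteredFamilies (hN : 0 < N) (m : ℕ) (hτ : 0 < τ) {L : ℕ}
    (φ : Fin L → Finset ι) : IsClosed (clusteredFamilies N m τ φ) := by
  have hsep : IsClosed (separatedFamilies ι N τ) := isClosed_separatedFamilies
  have hthreshold (i j) : IsClosed {x ∈ separatedFamilies ι N τ |
      separationThreshold m (clusterComplexity N (Finset.univ.image x)) ≤
        N * dist (x i) (x j)} :=
    hsep.isClosed_le ((continuous_separationThreshold m).comp_continuousOn
      (continuousOn_clusterComplexity_image_univ hN hτ)) (by fun_prop)
  have hthresholds := hsep.inter <| isClosed_iInter fun l => isClosed_iInter fun l' =>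
    isClosed_iInter fun _ : l ≠ l' => isClosed_iInter fun i => isClosed_iInter fun _ : i ∈ φ l =>
      isClosed_iInter fun j => isClosed_iInter fun _ : j ∈ φ l' => hthreshold i j
  have hmin := isClosed_setOf_exists_mul_dist_eq (ι := ι) (N := N) (τ := τ)
  have hclusters := isClosed_iInter fun l => isClosed_setOf_isCluster_image (N := N) (φ l)
  convert hthresholds.inter (hmin.inter hclusters) using 1
  ext x
  simp only [clusteredFamilies, Set.mem_inter_iff, Set.mem_iInter, Set.mem_ofPred_eq]
  exact ⟨fun ⟨hs, hmin, hcl, ht⟩ => ⟨⟨hs, fun l l' hl i hi j hj => ⟨hs, ht l l' hl i hi j hj⟩⟩,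
    hmin, hcl⟩, fun ⟨⟨hs, ht⟩, hmin, hcl⟩ => ⟨hs, hmin, hcl, fun l l' hl i hi j hj =>
      (ht l l' hl i hi j hj).2⟩⟩

end ClosedConditions

section ExistenceOfMinimum

variable {ι : Type*} {N m L : ℕ} {τ : ℝ}

/-- The conditions on an admissible configuration that only concern the index sets `φ l` of its
clusters. -/
structure IsClusterIndexing (m : ℕ) (φ : Fin L → Finset ι) : Prop where
  nonempty : ∀ l, (φ l).Nonempty
  exists_mem : ∀ i, ∃ l, i ∈ φ l
  isGreatest_card : IsGreatest (Set.range fun l => (φ l).card) m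

theorem one_lt_separationThreshold (hm : 0 < m) {C : ℝ} (hC : 1 < C) :
    1 < separationThreshold m C :=
  (Real.lt_sqrt_of_sq_lt (by simpa using hC)).trans_le (sqrt_le_separationThreshold hm C)

section Subset

variable {Ω : Finset UnitAddCircle} {Λ : Fin L → Finset UnitAddCircle}

theorem IsClusteredConfiguration.subset (h : IsClusteredConfiguration N Ω Λ) (l : Fin L) :
    Λ l ⊆ Ω := by
  rw [← Finset.coe_subset, ← h.iUnion_eq]
  exact Set.subset_iUnion (fun l => (Λ l : Set UnitAddCircle)) l

theorem IsClusteredConfiguration.le_card (h : IsClusteredConfiguration N Ω Λ) : L ≤ Ω.card := by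
  choose t ht using h.nonempty
  have hsep := ofReal_le_clusterSeparation_iff.1
    (ENNReal.ofReal_one.symm ▸ h.one_lt_separation.le)
  have hinj : t.Injective := fun l l' hl => by
    by_contra hne
    have hle := hsep l l' hne (t l) (ht l) (t l') (ht l')
    rw [hl, dist_self, mul_zero] at hle
    linarith
  simpa using Finset.card_le_card_of_injOn (s := Finset.univ) t (fun l _ => h.subset l (ht l))
    hinj.injOn

end Subset

section Families

variable [DecidableEq UnitAddCircle] {x : ι → UnitAddCircle} {φ : Fin L → Finset ι}

theorem ofReal_le_clusterSeparation_image_iff {r : ℝ} :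
    ENNReal.ofReal r ≤ (clusterSeparation N fun l => (φ l).image x) ↔
      ∀ l l', l ≠ l' → ∀ i ∈ φ l, ∀ j ∈ φ l', r ≤ N * dist (x i) (x j) := by
  simp only [ofReal_le_clusterSeparation_iff, Finset.forall_mem_image]

variable [Fintype ι]

theorem minimalSeparation_image_univ_eq_iff (hN : 0 < N) (hτ : 0 < τ) (hx : x.Injective) :
    minimalSeparation N (Finset.univ.image x) = τ ↔
      x ∈ separatedFamilies ι N τ ∧ ∃ i j, i ≠ j ∧ N * dist (x i) (x j) = τ := by
  simp [minimalSeparation_eq_iff hN hτ, separatedFamilies, hx.eq_iff]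

theorem image_univ_mem_admissibleConfigurations (hm : 0 < m) (hτ : 0 < τ) (hτ_lt : τ < 1)
    (hcard : Fintype.card ι < N) (hφ : IsClusterIndexing m φ)
    (hx : x ∈ clusteredFamilies N m τ φ) :
    Finset.univ.image x ∈ admissibleConfigurations N m τ := by
  obtain ⟨hsep, hmin, hcluster, hthreshold⟩ := hx
  have hinj := injective_of_mem_separatedFamilies hτ hsep
  have hN : 0 < N := by omega
  have hτ_eq := (minimalSeparation_image_univ_eq_iff hN hτ hinj).2 ⟨hsep, hmin⟩
  have hle := ofReal_le_clusterSeparation_image_iff.2 hthreshold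
  have hone := one_lt_separationThreshold hm <|
    ((one_lt_div hτ).2 hτ_lt).trans_le (one_div_le_clusterComplexity hN hτ hτ_eq)
  refine ⟨(Finset.card_image_of_injective _ hinj).trans_lt hcard, hτ_eq, L,
    fun l => (φ l).image x, ⟨fun l => (hφ.nonempty l).image x, ?_, hcluster, ?_⟩, ?_, hle⟩
  · ext t
    simp only [Set.mem_iUnion, Finset.mem_coe, Finset.mem_image, Finset.mem_univ, true_and]
    exact ⟨fun ⟨_, i, _, h⟩ => ⟨i, h⟩, fun ⟨i, h⟩ => (hφ.exists_mem i).imp fun _ hi => ⟨i, hi, h⟩⟩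
  · exact (ENNReal.one_lt_ofReal.2 hone).trans_le hle
  · simpa only [Finset.card_image_of_injective _ hinj] using hφ.isGreatest_card

theorem exists_mem_clusteredFamilies (hN : 0 < N) (hτ : 0 < τ) (hx : x.Injective)
    (h : Finset.univ.image x ∈ admissibleConfigurations N m τ) :
    ∃ L < N, ∃ φ : Fin L → Finset ι, IsClusterIndexing m φ ∧ x ∈ clusteredFamilies N m τ φ := by
  obtain ⟨hcard, hτ_eq, L, Λ, hΛ, hgreatest, hle⟩ := h
  choose φ _ hφ using fun l => Finset.subset_image_iff.1 (hΛ.subset l)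
  obtain rfl : (fun l => (φ l).image x) = Λ := funext hφ
  obtain ⟨hsep, hmin⟩ := (minimalSeparation_image_univ_eq_iff hN hτ hx).1 hτ_eq
  refine ⟨L, hΛ.le_card.trans_lt hcard, φ, ⟨fun l => Finset.image_nonempty.1 (hΛ.nonempty l),
    fun i => ?_, ?_⟩, hsep, hmin, hΛ.isCluster, ofReal_le_clusterSeparation_image_iff.1 hle⟩
  · have hmem : x i ∈ ⋃ l, ((φ l).image x : Set UnitAddCircle) := by
      rw [hΛ.iUnion_eq]
      simp
    simpa [hx.eq_iff] using hmem
  · simpa only [Finset.card_image_of_injective _ hx] using hgreatest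

theorem image_admissibleConfigurations (hN : 0 < N) (hm : 0 < m) (hτ : 0 < τ) (hτ_lt : τ < 1) :
    (fun Ω => sigmaMin (vandermondeMatrix N Ω)) '' admissibleConfigurations N m τ =
      ⋃ (M : Fin N) (L : Fin N) (φ : Fin L → Finset (Fin M)) (_ : IsClusterIndexing m φ),
        (fun x => sigmaMin (familyVandermonde N x)) '' clusteredFamilies N m τ φ := by
  ext σ
  simp only [Set.mem_iUnion]
  constructor
  · rintro ⟨Ω, hΩ, rfl⟩
    let x : Fin Ω.card → UnitAddCircle := fun i => Ω.equivFin.symm i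
    have hinj : x.Injective := Subtype.val_injective.comp Ω.equivFin.symm.injective
    have himage : Finset.univ.image x = Ω := by
      rw [← Finset.coe_inj, Finset.coe_image, Finset.coe_univ, Set.image_univ]
      exact (Ω.equivFin.symm.surjective.range_comp Subtype.val).trans Subtype.range_coe
    rw [← himage] at hΩ
    obtain ⟨L, hL, φ, hφ, hx⟩ := exists_mem_clusteredFamilies hN hτ hinj hΩ
    refine ⟨⟨Ω.card, himage ▸ hΩ.1⟩, ⟨L, hL⟩, φ, hφ, x, hx, ?_⟩
    change sigmaMin _ = sigmaMin _
    rw [← sigmaMin_vandermondeMatrix_image N hinj, himage]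
  · rintro ⟨M, L, φ, hφ, x, hx, rfl⟩
    refine ⟨Finset.univ.image x, image_univ_mem_admissibleConfigurations hm hτ hτ_lt
      (by simp) hφ hx, ?_⟩
    exact sigmaMin_vandermondeMatrix_image N (injective_of_mem_separatedFamilies hτ hx.1)

end Families

theorem isCompact_image_admissibleConfigurations (hN : 0 < N) (hm : 0 < m) (hτ : 0 < τ)
    (hτ_lt : τ < 1) :
    IsCompact ((fun Ω => sigmaMin (vandermondeMatrix N Ω)) '' admissibleConfigurations N m τ) := by
  classical
  rw [image_admissibleConfigurations hN hm hτ hτ_lt]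
  exact isCompact_iUnion fun M => isCompact_iUnion fun L => isCompact_iUnion fun φ =>
    isCompact_iUnion fun _ => (isClosed_clusteredFamilies hN m hτ φ).isCompact.image
      (continuous_sigmaMin_familyVandermonde N)

end ExistenceOfMinimum

section EquispacedNodes

variable {N m : ℕ} {h τ : ℝ}

/-- `m` nodes at consecutive distance `h`, starting at `0`: the extremal configurations, up to
constants, when they form a single cluster. -/
noncomputable def equispacedNodes (m : ℕ) (h : ℝ) (i : Fin m) : UnitAddCircle :=
  ((i : ℝ) * h : ℝ)

theorem dist_equispacedNodes (hh : 0 ≤ h) (hmh : m * h ≤ 1 / 2) (i j : Fin m) :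
    dist (equispacedNodes m h i) (equispacedNodes m h j) = |(i : ℝ) - j| * h := by
  have habs : |(i : ℝ) * h - j * h| = |(i : ℝ) - j| * h := by
    rw [← sub_mul, abs_mul, abs_of_nonneg hh]
  have hij : |(i : ℝ) - j| ≤ m := abs_sub_le_of_nonneg_of_le (Nat.cast_nonneg _)
    (by exact_mod_cast i.2.le) (Nat.cast_nonneg _) (by exact_mod_cast j.2.le)
  rw [dist_eq_norm, equispacedNodes, equispacedNodes, ← AddCircle.coe_sub,
    norm_coe_unitAddCircle_of_abs_le, habs]
  exact habs ▸ (mul_le_mul_of_nonneg_right hij hh).trans hmh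

theorem equispacedNodes_injective (hh : 0 < h) (hmh : m * h ≤ 1 / 2) :
    (equispacedNodes m h).Injective := fun i j hij => by
  have hdist := dist_equispacedNodes hh.le hmh i j
  rw [hij, dist_self, zero_eq_mul, or_iff_left hh.ne', abs_eq_zero, sub_eq_zero] at hdist
  exact Fin.ext (by exact_mod_cast hdist)

theorem isCluster_image_equispacedNodes [DecidableEq UnitAddCircle] (hh : 0 ≤ h)
    (hmh : m * h ≤ 1 / N) (s : Finset (Fin m)) : IsCluster N (s.image (equispacedNodes m h)) := by
  refine ⟨0, Finset.forall_mem_image.2 fun i _ => ⟨i * h, by positivity, ?_, rfl⟩⟩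
  have hi : (i : ℝ) ≤ m := by exact_mod_cast i.2.le
  rw [zero_add]
  exact (mul_le_mul_of_nonneg_right hi hh).trans hmh

theorem image_equispacedNodes_mem_admissibleConfigurations [DecidableEq UnitAddCircle]
    (hm : 2 ≤ m) (hmN : m < N) (hτ : 0 < τ) (hmτ : m * τ ≤ 1) :
    Finset.univ.image (equispacedNodes m (τ / N)) ∈ admissibleConfigurations N m τ := by
  have hN : (2 : ℝ) ≤ N := by exact_mod_cast hm.trans hmN.le
  have hmh : m * (τ / N) ≤ 1 / N := by
    rw [mul_div_assoc']
    gcongr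
  have hdist (i j : Fin m) : N * dist (equispacedNodes m (τ / N) i) (equispacedNodes m (τ / N) j) =
      |(i : ℝ) - j| * τ := by
    rw [dist_equispacedNodes (by positivity) (hmh.trans (by gcongr))]
    field_simp
  have hsingle : IsClusterIndexing m fun _ : Fin 1 => (Finset.univ : Finset (Fin m)) :=
    ⟨fun _ => ⟨⟨0, by omega⟩, Finset.mem_univ _⟩, fun i => ⟨0, Finset.mem_univ i⟩,
      ⟨⟨0, Finset.card_fin m⟩, by rintro _ ⟨l, rfl⟩; exact (Finset.card_fin m).le⟩⟩
  refine image_univ_mem_admissibleConfigurations (by omega) hτ ?_ (by simpa using hmN) hsingle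
    ⟨fun i j hij => ?_, ⟨⟨0, by omega⟩, ⟨1, by omega⟩, by simp, by simp [hdist]⟩,
      fun _ => isCluster_image_equispacedNodes (by positivity) hmh _,
      fun l l' hl => absurd (Subsingleton.elim l l') hl⟩
  · have : (2 : ℝ) ≤ m := by exact_mod_cast hm
    nlinarith
  · rw [hdist]
    refine le_mul_of_one_le_left hτ.le ?_
    have hne : (i : ℤ) - j ≠ 0 := fun h => hij (Fin.ext (by omega))
    exact_mod_cast Int.one_le_abs hne

/-- The coefficients `(-1) ^ j * d.choose j` of the `d`-th finite difference. -/
noncomputable def differenceVector (d : ℕ) : EuclideanSpace ℂ (Fin (d + 1)) :=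
  WithLp.toLp 2 fun j => (-1) ^ (j : ℕ) * (d.choose j : ℂ)

theorem one_le_norm_differenceVector (d : ℕ) : 1 ≤ ‖differenceVector d‖ := by
  simpa [differenceVector] using PiLp.norm_apply_le (differenceVector d) 0

theorem conjTranspose_familyVandermonde_mulVec_differenceVector (N d : ℕ) (h : ℝ) (k : Fin N) :
    (familyVandermonde N (equispacedNodes (d + 1) h)).conjTranspose.mulVec
        (differenceVector d).ofLp k =
      star ((1 - Complex.exp (Complex.I * (2 * Real.pi * (k * h) : ℝ))) ^ d) := by
  have hpow (j : Fin (d + 1)) :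
      (AddCircle.toCircle (equispacedNodes (d + 1) h j) : ℂ) ^ (k : ℕ) =
        Complex.exp (Complex.I * (2 * Real.pi * (k * h) : ℝ)) ^ (j : ℕ) := by
    rw [equispacedNodes, AddCircle.toCircle_apply_mk, Circle.coe_exp, ← Complex.exp_nat_mul,
      ← Complex.exp_nat_mul]
    congr 1
    push_cast
    ring
  rw [sub_eq_neg_add, add_pow, star_sum, Finset.sum_range]
  simp only [Matrix.mulVec, dotProduct, Matrix.conjTranspose_apply, familyVandermonde,
    Matrix.of_apply, hpow, differenceVector]
  refine Finset.sum_congr rfl fun j _ => ?_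
  simp only [one_pow, mul_one, star_mul', star_pow, star_neg, star_natCast]
  rw [neg_pow]
  simp
  ring

theorem sigmaMin_equispacedNodes_le (N d : ℕ) (hh : 0 ≤ h) :
    sigmaMin (familyVandermonde N (equispacedNodes (d + 1) h)) ≤
      √N * (2 * Real.pi * (N * h)) ^ d := by
  set A := familyVandermonde N (equispacedNodes (d + 1) h)
  have hentry (k : Fin N) : ‖A.conjTranspose.mulVec (differenceVector d).ofLp k‖ ≤
      (2 * Real.pi * (N * h)) ^ d := by
    have hk : (k : ℝ) ≤ N := by exact_mod_cast k.2.le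
    rw [conjTranspose_familyVandermonde_mulVec_differenceVector, norm_star, norm_pow,
      norm_sub_rev]
    gcongr
    refine Real.norm_exp_I_mul_ofReal_sub_one_le.trans ?_
    rw [Real.norm_of_nonneg (by positivity)]
    gcongr
  calc sigmaMin A ≤ sigmaMin A * ‖differenceVector d‖ :=
        le_mul_of_one_le_right (sigmaMin_nonneg A) (one_le_norm_differenceVector d)
    _ ≤ ‖WithLp.toLp 2 (A.conjTranspose.mulVec (differenceVector d).ofLp)‖ :=
        sigmaMin_mul_norm_le A _
    _ ≤ √(∑ _k : Fin N, ((2 * Real.pi * (N * h)) ^ d) ^ 2) := by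
        rw [EuclideanSpace.norm_eq]
        gcongr with k
        exact hentry k
    _ = √N * (2 * Real.pi * (N * h)) ^ d := by
        rw [Finset.sum_const, Finset.card_fin, nsmul_eq_mul, Real.sqrt_mul N.cast_nonneg,
          Real.sqrt_sq (by positivity)]

theorem sigmaMin_image_equispacedNodes_le [DecidableEq UnitAddCircle] (hm : 1 ≤ m) (hN : 2 ≤ N)
    (hτ : 0 < τ) (hmτ : m * τ ≤ 1) :
    sigmaMin (vandermondeMatrix N (Finset.univ.image (equispacedNodes m (τ / N)))) ≤
      √N * (2 * Real.pi * τ) ^ (m - 1) := by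
  have hN' : (2 : ℝ) ≤ N := by exact_mod_cast hN
  have hmh : m * (τ / N) ≤ 1 / 2 := by
    rw [mul_div_assoc']
    gcongr
  rw [sigmaMin_vandermondeMatrix_image N (equispacedNodes_injective (by positivity) hmh)]
  obtain ⟨d, rfl⟩ := Nat.exists_eq_add_of_le' hm
  have hscale : N * (τ / N) = τ := by field_simp
  simpa only [hscale, Nat.add_sub_cancel] using
    sigmaMin_equispacedNodes_le N d (h := τ / N) (by positivity)

end EquispacedNodes

theorem mainTheorem7 :
    ∃ c₁ c₂ : ℝ, 0 < c₁ ∧ c₁ ≤ c₂ ∧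
      ∀ m : ℕ, 2 ≤ m →
        ∃ (N₀ : ℕ) (τ₀ : ℝ), 0 < τ₀ ∧
          ∀ N : ℕ, N₀ ≤ N → ∀ τ : ℝ, 0 < τ → τ ≤ τ₀ →
            ∃ σ : ℝ,
              IsLeast ((fun Ω => sigmaMin (vandermondeMatrix N Ω)) ''
                admissibleConfigurations N m τ) σ ∧
              √(N : ℝ) * (c₁ * τ) ^ (m - 1) ≤ σ ∧ σ ≤ √(N : ℝ) * (c₂ * τ) ^ (m - 1) := by
  classical
  refine ⟨1 / 12150, 2 * Real.pi, by norm_num, by linarith [Real.pi_gt_three], fun m hm => ?_⟩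
  refine ⟨m + 3, 1 / (8 * m * (m + 3) ^ (m + 4)), by positivity, fun N hN τ hτ hτ_le => ?_⟩
  have hmτ : m * τ ≤ 1 / 8 := mul_le_one_eighth (by omega) hτ_le
  have hmem : Finset.univ.image (equispacedNodes m (τ / N)) ∈ admissibleConfigurations N m τ :=
    image_equispacedNodes_mem_admissibleConfigurations hm (by omega) hτ (by linarith)
  have hτ_lt : τ < 1 := by
    have : (2 : ℝ) ≤ m := by exact_mod_cast hm
    nlinarith
  obtain ⟨σ, hσ⟩ := (isCompact_image_admissibleConfigurations (N := N) (m := m) (by omega)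
    (by omega) hτ hτ_lt).exists_isLeast ⟨_, _, hmem, rfl⟩
  refine ⟨σ, hσ, ?_, (hσ.2 ⟨_, hmem, rfl⟩).trans ?_⟩
  · obtain ⟨Ω, hΩ, rfl⟩ := hσ.1
    exact sqrt_mul_pow_le_sigmaMin hm hN hτ hτ_le hΩ
  · exact sigmaMin_image_equispacedNodes_le (by omega) (by omega) hτ (by linarith)
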